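/- **Theorem (arbitrary quantum state preparation).** For $n\ge 1$ let $N=2^n$, and consider the following layout of qubits: a complete binary tree $H$ with layers $0,\dots,n$, where $H_{l,j}$ ($0\le j<2^l$) is the $j$th node of layer $l$; and, for each $1\le l\le n$, a complete binary tree $V_l$ with layers $0,\dots,l$, whose $j$th leaf is linked to $H_{l,j}$. A circuit is a sequence of layers, each consisting of arbitrary one- and two-qubit unitary gates on pairwise disjoint sets of qubits; its depth is the number of layers. (i) There are constants $A,C$ such that for every $n\ge1$ the layout has at most $n+A N$ qubits ($n$ output qubits, the roots of $V_1,\dots,V_n$ in this order, and $O(N)$ ancillas), and there is a set of links of the layout, depending only on $n$ and coupling each qubit to at most $3$ others, such that for every $n$-qubit pure state $|\psi\rangle$ some circuit of depth at most $Cn$, whose two-qubit gates act only along these links, maps $|0\cdots0\rangle$ exactly to $|\psi\rangle\otimes|0\cdots0\rangle$ ($|\psi\rangle$ on the output qubits, all ancillas in $|0\rangle$). (ii) This depth is optimal: there is a constant $a>0$ such that for every $n\ge1$ there is an $n$-qubit pure state $|\psi\rangle$ such that every circuit of one- and two-qubit gates, on any finite number of qubits and with no restriction on couplings, that maps $|0\cdots0\rangle$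 to $|\psi\rangle\otimes|\varphi\rangle$ for some state $|\varphi\rangle$ of the ancillas has depth at least $a n$. Hence the depth needed for arbitrary $n$-qubit states is $\Theta(n)$, and it is achieved with $O(N)$ ancillary qubits. -/

import Mathlib

/-- Amplitude vectors of a register whose qubits are labelled by `Q`. A computational basis state is
an assignment `x : Q → Fin 2` of bits to the qubits. -/
abbrev Amplitudes (Q : Type) : Type := (Q → Fin 2) → ℂ

/-- The normalized pure states of a finite register. -/
def IsState {Q : Type} [Fintype Q] [DecidableEq Q] (ψ : Amplitudes Q) : Prop :=
  ∑ x : Q → Fin 2, ‖ψ x‖ ^ 2 = 1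

open Classical in
/-- The state `|0…0⟩`. -/
noncomputable def zeroState (Q : Type) : Amplitudes Q :=
  fun x => if ∀ q, x q = 0 then 1 else 0

/-- The product of the state `ψ` of the `n` output qubits `out 0, …, out (n - 1)` and of the state
`φ` of all the other qubits, the ancillas. -/
def productState {n : ℕ} {Q : Type} (out : Fin n ↪ Q) (ψ : Amplitudes (Fin n))
    (φ : Amplitudes {q : Q // q ∉ Set.range out}) : Amplitudes Q :=
  fun x => ψ (fun i => x (out i)) * φ (fun q => x q.1)

/-- A gate is an arbitrary unitary acting on one qubit, or on two distinct qubits. -/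
inductive Gate (Q : Type) : Type
  | single (q : Q) (U : Matrix.unitaryGroup (Fin 2) ℂ) : Gate Q
  | double (p q : Q) (hpq : p ≠ q) (U : Matrix.unitaryGroup (Fin 2 × Fin 2) ℂ) : Gate Q

namespace Gate

/-- The qubits a gate acts on. -/
def support {Q : Type} : Gate Q → Set Q
  | single q _ => {q}
  | double p q _ _ => {p, q}

/-- The two-qubit gates allowed by a coupling graph are those along its edges. Single-qubit gates
are always allowed. -/
def Respects {Q : Type} (G : SimpleGraph Q) : Gate Q → Prop
  | single _ _ => True
  | double p q _ _ => G.Adj p q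

/-- The action of a gate on amplitude vectors: the given unitary on the qubits of its support,
tensored with the identity on all the others. -/
def apply {Q : Type} [DecidableEq Q] : Gate Q → Amplitudes Q → Amplitudes Q
  | single q U, ψ => fun x => ∑ b : Fin 2, U.1 (x q) b * ψ (Function.update x q b)
  | double p q _ U, ψ => fun x => ∑ b : Fin 2 × Fin 2,
      U.1 (x p, x q) b * ψ (Function.update (Function.update x p b.1) q b.2)

end Gate

/-- A circuit is a sequence of layers. The gates of one layer act on pairwise disjoint sets of
qubits, so that they can be executed simultaneously. -/
structure Circuit (Q : Type) : Type where
  layers : List (List (Gate Q))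
  disjoint : ∀ L ∈ layers, L.Pairwise fun g h => Disjoint g.support h.support

namespace Circuit

/-- The depth is the number of layers. -/
def depth {Q : Type} (c : Circuit Q) : ℕ := c.layers.length

/-- All the two-qubit gates of the circuit act along edges of the graph. -/
def Respects {Q : Type} (c : Circuit Q) (G : SimpleGraph Q) : Prop :=
  ∀ L ∈ c.layers, ∀ g ∈ L, g.Respects G

/-- Run the layers in order, the first layer of the list first. The order inside a layer is
irrelevant, since its gates have disjoint supports. -/
def run {Q : Type} [DecidableEq Q] (c : Circuit Q) (ψ : Amplitudes Q) : Amplitudes Q :=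
  c.layers.foldl (fun s L => L.foldl (fun t g => g.apply t) s) ψ

end Circuit

/-- Labels of nodes: `H l j` is node `j` of layer `l` of the tree `H`, and `V l m j` is node `j` of
layer `m` of the tree `V l`. -/
inductive Node : Type
  | H (l j : ℕ) : Node
  | V (l m j : ℕ) : Node
  deriving DecidableEq

namespace Node

/-- `H` is a complete binary tree with layers `0, …, n`. For `1 ≤ l ≤ n` there is a complete binary
tree `V l` with layers `0, …, l`. -/
def Valid (n : ℕ) : Node → Prop
  | H l j => l ≤ n ∧ j < 2 ^ l
  | V l m j => 1 ≤ l ∧ l ≤ n ∧ m ≤ l ∧ j < 2 ^ m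

/-- The links: from a parent to its children `2 * j` and `2 * j + 1` in the same tree, and from
node `j` of layer `l` of `H` to leaf `j` of `V l`. -/
def Link : Node → Node → Prop
  | H l j, H l' j' => l' = l + 1 ∧ (j' = 2 * j ∨ j' = 2 * j + 1)
  | V l m j, V l' m' j' => l' = l ∧ m' = m + 1 ∧ (j' = 2 * j ∨ j' = 2 * j + 1)
  | H l j, V l' m' j' => l' = l ∧ m' = l ∧ j' = j
  | V _ _ _, H _ _ => False

theorem finite_valid (n : ℕ) : {q : Node | q.Valid n}.Finite := by
  have h1 : ((Finset.range (n + 1) ×ˢ Finset.range (2 ^ n)).image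
      (fun p : ℕ × ℕ => H p.1 p.2) : Set Node).Finite := Finset.finite_toSet _
  have h2 : ((Finset.range (n + 1) ×ˢ Finset.range (n + 1) ×ˢ Finset.range (2 ^ n)).image
      (fun p : ℕ × ℕ × ℕ => V p.1 p.2.1 p.2.2) : Set Node).Finite := Finset.finite_toSet _
  refine (h1.union h2).subset ?_
  rintro (⟨l, j⟩ | ⟨l, m, j⟩) h
  · obtain ⟨hl, hj⟩ := h
    have := Nat.pow_le_pow_right (n := 2) (by norm_num) hl
    left
    simp only [Finset.coe_image, Set.mem_image, Finset.mem_coe, Finset.mem_product,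
      Finset.mem_range]
    exact ⟨(l, j), ⟨by simp only; omega, by simp only; omega⟩, rfl⟩
  · obtain ⟨_, hl, hm, hj⟩ := h
    have := Nat.pow_le_pow_right (n := 2) (by norm_num) (hm.trans hl)
    right
    simp only [Finset.coe_image, Set.mem_image, Finset.mem_coe, Finset.mem_product,
      Finset.mem_range]
    exact ⟨(l, m, j), ⟨by simp only; omega, by simp only; omega, by simp only; omega⟩, rfl⟩

end Node

/-- The qubits of the layout for preparing `n`-qubit states: the nodes of `H` and of all `V l`. -/
abbrev TreeQubit (n : ℕ) : Type := {q : Node // q.Valid n}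

noncomputable instance (n : ℕ) : Fintype (TreeQubit n) := (Node.finite_valid n).fintype

/-- The layout, as a graph on the qubits. -/
def treeGraph (n : ℕ) : SimpleGraph (TreeQubit n) :=
  SimpleGraph.fromRel fun p q => p.1.Link q.1

/-- The output qubits are the roots of `V 1, …, V n`, in this order. -/
def treeOutput (n : ℕ) : Fin n ↪ TreeQubit n where
  toFun i := ⟨Node.V (i + 1) 0 0, by
    have := i.2
    simp only [Node.Valid]
    omega⟩
  inj' i k h := by
    simp only [Subtype.mk.injEq, Node.V.injEq] at h
    exact Fin.ext (by omega)

/-!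
The depth of the preparation of an arbitrary state is linear in the number `n` of qubits.

**Upper bound.** The idea is to distribute the amplitudes in unary and to convert to binary
afterwards. A single excitation of the root of `H` grows into a superposition of the paths to the
leaves of `H`: every layer takes a constant number of gates, since a node only has to pass the
excitation on to its left or its right child (`exists_branch_layer`, `exists_distribute`). Suitable
amplitudes in these branchings give the state `∑ k, ψ k |path to leaf k⟩`. The rest is a map of
basis states (`mapsKets_onPath_onOutputs`). The `l`th bit of `k` is the parity of the ancestor of
leaf `k` in layer `l`. It is added up in `V l` from a copy of the path at the leaves, all `l` at
once, and the work space of the sum is uncomputed. The path itself has to be erased too, and this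
is the point of the trees `V l`: from their roots, the outputs, the bits are spread to all the
leaves, so that the choice between the two children of a node of `H` can be undone locally, layer
by layer from the bottom (`eraseGates_ket`, `mapsKets_erase`). Undoing the spreading leaves only
the outputs.

In the full layout the inner nodes of `H` have four neighbours. The circuit never uses the link
from a node to its left child, and works on the path of six qubits through `V (l + 1)` instead
(`cell`).

**Lower bound.** By `exists_light_cone`, all but at most `n * (2 ^ d - 1)` gates of a circuit of
depth `d` can be postponed until they act on the ancillas only. Undoing these changes the final
state of the ancillas, but not that of the outputs. So the ratios of the amplitudes of `ψ` lie in
the field generated over `ℚ` by the entries of the remaining gates, at most 16 for each. If the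
`2 ^ n - 1` ratios are algebraically independent, then `2 ^ n - 1 ≤ 16 * n * (2 ^ d - 1)`
(`two_pow_le_of_run_eq`).
-/

/-! ### Gates as linear maps -/

open Classical in
/-- The computational basis state `|x⟩`. -/
noncomputable def ket {Q : Type} (x : Q → Fin 2) : Amplitudes Q := fun y => if y = x then 1 else 0

theorem zeroState_eq_ket (Q : Type) : zeroState Q = ket 0 := by
  funext x
  have h : (∀ q, x q = 0) ↔ x = 0 := funext_iff.symm
  unfold zeroState ket
  split_ifs <;> tauto

theorem ket_ne_zero {Q : Type} (x : Q → Fin 2) : ket x ≠ 0 := fun h => by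
  simpa [ket] using congrFun h x

namespace Gate

variable {Q : Type}

/-- The inverse gate. -/
def inv : Gate Q → Gate Q
  | single q U => single q U⁻¹
  | double p q hpq U => double p q hpq U⁻¹

theorem support_inv (g : Gate Q) : g.inv.support = g.support := by
  cases g <;> rfl

variable [DecidableEq Q]

/-- The action of a gate, as a linear operator. -/
def lin (g : Gate Q) : Module.End ℂ (Amplitudes Q) where
  toFun := g.apply
  map_add' ψ φ := by
    funext x
    cases g <;> simp [apply, mul_add, Finset.sum_add_distrib]
  map_smul' c ψ := by
    funext x
    cases g <;> simp only [apply, Pi.smul_apply, smul_eq_mul, RingHom.id_apply, Finset.mul_sum,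
      mul_left_comm]

theorem lin_apply (g : Gate Q) (ψ : Amplitudes Q) : g.lin ψ = g.apply ψ := rfl

theorem commute_lin {g h : Gate Q} (H : Disjoint g.support h.support) : Commute g.lin h.lin := by
  refine LinearMap.ext fun ψ => funext fun x => ?_
  simp only [Module.End.mul_apply, lin_apply]
  cases g with
  | single p U =>
    cases h with
    | single q V =>
      have h1 : p ≠ q := by simpa [support] using H
      simp only [apply, Finset.mul_sum, Function.update_of_ne h1, Function.update_of_ne h1.symm]
      rw [Finset.sum_comm]
      simp only [Function.update_comm h1, mul_left_comm]
    | double q r hqr V =>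
      have h1 : q ≠ p ∧ r ≠ p := by simpa [support, eq_comm] using H
      obtain ⟨h1, h2⟩ := h1
      simp only [apply, Finset.mul_sum, Function.update_of_ne h1, Function.update_of_ne h1.symm,
        Function.update_of_ne h2, Function.update_of_ne h2.symm]
      rw [Finset.sum_comm]
      simp only [Function.update_comm h1, Function.update_comm h2, mul_left_comm]
  | double p p' hp U =>
    cases h with
    | single q V =>
      have h1 : p ≠ q ∧ p' ≠ q := by simpa [support, eq_comm] using H
      obtain ⟨h1, h2⟩ := h1
      simp only [apply, Finset.mul_sum, Function.update_of_ne h1, Function.update_of_ne h1.symm,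
        Function.update_of_ne h2, Function.update_of_ne h2.symm]
      rw [Finset.sum_comm]
      simp only [Function.update_comm h1, Function.update_comm h2, mul_left_comm]
    | double q r hqr V =>
      have h1 : (p ≠ q ∧ p' ≠ q) ∧ p ≠ r ∧ p' ≠ r := by
        simpa [support, eq_comm, not_or] using H
      obtain ⟨⟨h1, h3⟩, h2, h4⟩ := h1
      simp only [apply, Finset.mul_sum, Function.update_of_ne h1, Function.update_of_ne h1.symm,
        Function.update_of_ne h2, Function.update_of_ne h2.symm, Function.update_of_ne h3,
        Function.update_of_ne h3.symm, Function.update_of_ne h4, Function.update_of_ne h4.symm]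
      rw [Finset.sum_comm]
      simp only [Function.update_comm h1, Function.update_comm h2, Function.update_comm h3,
        Function.update_comm h4, mul_left_comm]

theorem apply_inv_apply (g : Gate Q) (ψ : Amplitudes Q) : g.inv.apply (g.apply ψ) = ψ := by
  funext x
  cases g with
  | single q U =>
    have h (a c : Fin 2) : ∑ b, (U⁻¹).1 a b * U.1 b c = (1 : Matrix (Fin 2) (Fin 2) ℂ) a c := by
      rw [← Matrix.mul_apply]
      exact congrFun (congrFun (congrArg Subtype.val (inv_mul_cancel U)) a) c
    simp only [inv, apply, Finset.mul_sum, Function.update_self, Function.update_idem,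
      ← mul_assoc]
    rw [Finset.sum_comm]
    simp only [← Finset.sum_mul, h, Matrix.one_apply, ite_mul, one_mul, zero_mul,
      Finset.sum_ite_eq, Finset.mem_univ, if_true, Function.update_eq_self]
  | double p q hpq U =>
    have h (a c : Fin 2 × Fin 2) : ∑ b, (U⁻¹).1 a b * U.1 b c =
        (1 : Matrix (Fin 2 × Fin 2) (Fin 2 × Fin 2) ℂ) a c := by
      rw [← Matrix.mul_apply]
      exact congrFun (congrFun (congrArg Subtype.val (inv_mul_cancel U)) a) c
    have hu (b c : Fin 2 × Fin 2) : Function.update (Function.update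
        (Function.update (Function.update x p b.1) q b.2) p c.1) q c.2 =
        Function.update (Function.update x p c.1) q c.2 := by
      rw [Function.update_comm hpq.symm, Function.update_idem, Function.update_idem]
    simp only [inv, apply, Finset.mul_sum, Function.update_self, Function.update_of_ne hpq, hu,
      ← mul_assoc]
    rw [Finset.sum_comm]
    simp only [← Finset.sum_mul, h, Matrix.one_apply, ite_mul, one_mul, zero_mul,
      Finset.sum_ite_eq, Finset.mem_univ, if_true, Function.update_eq_self]

end Gate

/-- The operator of a list of gates executed one after the other, the head of the list first. -/
def runGates {Q : Type} [DecidableEq Q] : List (Gate Q) → Module.End ℂ (Amplitudes Q)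
  | [] => 1
  | g :: gs => runGates gs * g.lin

section

variable {Q : Type} [DecidableEq Q]

theorem runGates_append (gs hs : List (Gate Q)) :
    runGates (gs ++ hs) = runGates hs * runGates gs := by
  induction gs with
  | nil => simp [runGates]
  | cons g gs ih => simp [runGates, ih, mul_assoc]

theorem runGates_eq_foldl (gs : List (Gate Q)) (ψ : Amplitudes Q) :
    runGates gs ψ = gs.foldl (fun t g => g.apply t) ψ := by
  induction gs generalizing ψ with
  | nil => rfl
  | cons g gs ih => simp [runGates, ← ih, Gate.lin_apply]

theorem Circuit.run_eq (c : Circuit Q) (ψ : Amplitudes Q) :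
    c.run ψ = runGates c.layers.flatten ψ := by
  unfold Circuit.run
  generalize c.layers = Ls
  induction Ls generalizing ψ with
  | nil => rfl
  | cons L Ls ih => simp [ih, runGates_append, runGates_eq_foldl]

theorem commute_runGates {gs hs : List (Gate Q)}
    (H : ∀ g ∈ gs, ∀ h ∈ hs, Disjoint g.support h.support) :
    Commute (runGates gs) (runGates hs) := by
  induction gs with
  | nil => exact Commute.one_left _
  | cons g gs ih =>
    refine (ih fun g hg => H g (List.mem_cons_of_mem _ hg)).mul_left ?_
    have H' := H g List.mem_cons_self
    clear H ih
    induction hs with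
    | nil => exact Commute.one_right _
    | cons h hs ih =>
      exact (ih fun h hh => H' h (List.mem_cons_of_mem _ hh)).mul_right
        (Gate.commute_lin (H' h List.mem_cons_self))

theorem runGates_append_comm {gs hs : List (Gate Q)}
    (H : ∀ g ∈ gs, ∀ h ∈ hs, Disjoint g.support h.support) :
    runGates (gs ++ hs) = runGates (hs ++ gs) := by
  rw [runGates_append, runGates_append, (commute_runGates H).eq]

theorem runGates_injective (gs : List (Gate Q)) : Function.Injective (runGates gs) := by
  induction gs with
  | nil => exact Function.injective_id
  | cons g gs ih => exact ih.comp (Function.LeftInverse.injective g.apply_inv_apply)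

end

/-! ### The backward light cone of the outputs -/

section

variable {Q : Type}

/-- Disjoint gates that all touch `S` touch it in different qubits. -/
theorem length_le_card_of_touching [DecidableEq Q] {L : List (Gate Q)}
    (hL : L.Pairwise fun g h => Disjoint g.support h.support) {S : Finset Q}
    (hS : ∀ g ∈ L, ¬ Disjoint g.support (S : Set Q)) : L.length ≤ S.card := by
  induction L generalizing S with
  | nil => simp
  | cons g L ih =>
    obtain ⟨q, hqg, hqS⟩ := Set.not_disjoint_iff.1 (hS g List.mem_cons_self)
    rw [List.pairwise_cons] at hL
    have := ih hL.2 (S := S.erase q) fun h hh => by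
      obtain ⟨r, hrh, hrS⟩ := Set.not_disjoint_iff.1 (hS h (List.mem_cons_of_mem _ hh))
      refine Set.not_disjoint_iff.2 ⟨r, hrh, ?_⟩
      rw [Finset.mem_coe, Finset.mem_erase]
      refine ⟨?_, hrS⟩
      rintro rfl
      exact Set.disjoint_left.1 (hL.1 h hh) hqg hrh
    rw [Finset.card_erase_of_mem hqS] at this
    have : 0 < S.card := Finset.card_pos.2 ⟨q, hqS⟩
    simp only [List.length_cons]
    omega

/-- A gate that touches a set of qubits acts on at most one further qubit. -/
theorem exists_card_le_of_touching [DecidableEq Q] {L : List (Gate Q)} {S : Finset Q}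
    (hS : ∀ g ∈ L, ¬ Disjoint g.support (S : Set Q)) :
    ∃ T : Finset Q, S ⊆ T ∧ T.card ≤ S.card + L.length ∧ ∀ g ∈ L, g.support ⊆ (T : Set Q) := by
  induction L with
  | nil => exact ⟨S, subset_rfl, by simp, by simp⟩
  | cons g L ih =>
    obtain ⟨T, hST, hT, hL⟩ := ih fun h hh => hS h (List.mem_cons_of_mem _ hh)
    obtain ⟨q, hqg, hqS⟩ := Set.not_disjoint_iff.1 (hS g List.mem_cons_self)
    obtain ⟨r, hr⟩ : ∃ r, g.support ⊆ {q, r} := by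
      cases g with
      | single p U =>
        obtain rfl : q = p := hqg
        exact ⟨q, by simp [Gate.support]⟩
      | double p p' hp U =>
        obtain rfl | rfl : q = p ∨ q = p' := hqg
        · exact ⟨p', subset_rfl⟩
        · exact ⟨p, (Set.pair_comm _ _).subset⟩
    refine ⟨insert r T, hST.trans (Finset.subset_insert _ _), ?_, ?_⟩
    · have := Finset.card_insert_le r T
      simp only [List.length_cons]
      omega
    · intro h hh
      rcases List.mem_cons.1 hh with rfl | hh
      · refine hr.trans ?_
        rintro x (rfl | rfl)
        · exact Finset.mem_coe.2 (Finset.mem_insert_of_mem (hST hqS))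
        · exact Finset.mem_coe.2 (Finset.mem_insert_self _ _)
      · exact (hL h hh).trans (Finset.coe_subset.2 (Finset.subset_insert _ _))

open Classical in
theorem runGates_filter_append [DecidableEq Q] {L : List (Gate Q)}
    (hL : L.Pairwise fun g h => Disjoint g.support h.support) (P : Gate Q → Prop) :
    runGates L = runGates (L.filter (fun g => P g) ++ L.filter (fun g => ¬ P g)) := by
  have hcons (g : Gate Q) (L : List (Gate Q)) : runGates (g :: L) = runGates L * g.lin := rfl
  induction L with
  | nil => rfl
  | cons g L ih =>
    rw [List.pairwise_cons] at hL
    rw [hcons, ih hL.2]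
    by_cases hg : P g
    · simp only [List.filter_cons, hg, not_true, decide_false, decide_true, if_true,
        Bool.false_eq_true, if_false]
      rfl
    · simp only [List.filter_cons, hg, not_false_eq_true, decide_false, decide_true, if_true,
        Bool.false_eq_true, if_false]
      rw [← hcons, ← List.singleton_append, ← List.append_assoc, runGates_append,
        runGates_append_comm, ← runGates_append, List.append_assoc, List.singleton_append]
      simp only [List.mem_singleton, forall_eq]
      exact fun h hh => hL.1 h (List.mem_of_mem_filter hh)

/-- All the gates outside the backward light cone of a set `S` of qubits can be postponed to the
end of the circuit, where they do not act on `S`. -/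
theorem exists_light_cone [DecidableEq Q] (Ls : List (List (Gate Q)))
    (hLs : ∀ L ∈ Ls, L.Pairwise fun g h => Disjoint g.support h.support) (S : Finset Q) :
    ∃ gs ws : List (Gate Q), gs.length ≤ S.card * (2 ^ Ls.length - 1) ∧
      (∀ w ∈ ws, Disjoint w.support (S : Set Q)) ∧
      runGates Ls.flatten = runGates (gs ++ ws) := by
  classical
  induction Ls using List.reverseRecOn generalizing S with
  | nil => exact ⟨[], [], by simp, by simp, rfl⟩
  | append_singleton Ls L ih =>
    let I := L.filter fun g => ¬ Disjoint g.support (S : Set Q)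
    let O := L.filter fun g => Disjoint g.support (S : Set Q)
    have hL := hLs L (by simp)
    have hI : ∀ g ∈ I, ¬ Disjoint g.support (S : Set Q) := fun g hg => by
      simpa using (List.mem_filter.1 hg).2
    have hO : ∀ g ∈ O, Disjoint g.support (S : Set Q) := fun g hg => by
      simpa using (List.mem_filter.1 hg).2
    have hIS : I.length ≤ S.card := length_le_card_of_touching (hL.filter _) hI
    obtain ⟨T, hST, hT, hIT⟩ := exists_card_le_of_touching hI
    obtain ⟨gs, ws, hgs, hws, hrun⟩ := ih (fun M hM => hLs M (by simp [hM])) T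
    have hLrun : runGates L = runGates (I ++ O) := by
      simpa [I, O] using runGates_filter_append hL fun g => ¬ Disjoint g.support (S : Set Q)
    refine ⟨gs ++ I, ws ++ O, ?_, ?_, ?_⟩
    · have h1 : gs.length ≤ (2 * S.card) * (2 ^ Ls.length - 1) :=
        hgs.trans (Nat.mul_le_mul_right _ (by omega))
      have h2 : (2 : ℕ) ^ (Ls ++ [L]).length - 1 = 2 * (2 ^ Ls.length - 1) + 1 := by
        have := Nat.one_le_two_pow (n := Ls.length)
        simp only [List.length_append, List.length_singleton, pow_succ]
        omega
      rw [List.length_append, h2]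
      nlinarith
    · intro w hw
      rcases List.mem_append.1 hw with hw | hw
      · exact (hws w hw).mono_right (Finset.coe_subset.2 hST)
      · exact hO w hw
    · rw [List.flatten_append, runGates_append, hrun, List.flatten_singleton, hLrun,
        ← runGates_append]
      have : gs ++ ws ++ (I ++ O) = gs ++ ((ws ++ I) ++ O) := by simp
      rw [this, runGates_append, runGates_append (ws ++ I), runGates_append_comm,
        ← runGates_append, ← runGates_append]
      · simp
      · exact fun w hw g hg => (hws w hw).mono_right (hIT g hg)

/-- A vector is the product of the state `ψ` of the outputs and of an unnormalized state of the
ancillas, written as a function `F` on the whole register that ignores the outputs. -/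
def FactorsThrough {n : ℕ} (out : Fin n ↪ Q) (ψ : Amplitudes (Fin n)) (χ : Amplitudes Q) : Prop :=
  ∃ F : Amplitudes Q, (∀ x y, (∀ q, q ∉ Set.range out → x q = y q) → F x = F y) ∧
    ∀ x, χ x = ψ (x ∘ out) * F x

theorem FactorsThrough.apply [DecidableEq Q] {n : ℕ} {out : Fin n ↪ Q} {ψ : Amplitudes (Fin n)}
    {χ : Amplitudes Q} (h : FactorsThrough out ψ χ) (g : Gate Q)
    (hg : Disjoint g.support (Set.range out)) : FactorsThrough out ψ (g.apply χ) := by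
  obtain ⟨F, hF, hχ⟩ := h
  refine ⟨g.apply F, fun x y hxy => ?_, fun x => ?_⟩
  · cases g with
    | single p U =>
      have hp : p ∉ Set.range out := by simpa [Gate.support] using hg
      simp only [Gate.apply, hxy p hp]
      refine Finset.sum_congr rfl fun b _ => ?_
      rw [hF]
      intro q hq
      by_cases hqp : q = p
      · subst hqp; simp
      · simp [hqp, hxy q hq]
    | double p p' hp U =>
      have h1 : p ∉ Set.range out := fun h => Set.disjoint_left.1 hg (by simp [Gate.support]) h
      have h2 : p' ∉ Set.range out := fun h => Set.disjoint_left.1 hg (by simp [Gate.support]) h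
      simp only [Gate.apply, hxy p h1, hxy p' h2]
      refine Finset.sum_congr rfl fun b _ => ?_
      rw [hF]
      intro q hq
      simp only [Function.update_apply, hxy q hq]
  · cases g with
    | single p U =>
      have hp : p ∉ Set.range out := by simpa [Gate.support] using hg
      have hu (b : Fin 2) : Function.update x p b ∘ out = x ∘ out :=
        Function.update_comp_eq_of_notMem_range _ _ hp
      simp only [Gate.apply, hχ, hu, Finset.mul_sum, mul_left_comm]
    | double p p' hp U =>
      have h1 : p ∉ Set.range out := fun h => Set.disjoint_left.1 hg (by simp [Gate.support]) h
      have h2 : p' ∉ Set.range out := fun h => Set.disjoint_left.1 hg (by simp [Gate.support]) h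
      have hu (b c : Fin 2) : Function.update (Function.update x p b) p' c ∘ out = x ∘ out := by
        rw [Function.update_comp_eq_of_notMem_range _ _ h2,
          Function.update_comp_eq_of_notMem_range _ _ h1]
      simp only [Gate.apply, hχ, hu, Finset.mul_sum, mul_left_comm]

theorem FactorsThrough.of_runGates [DecidableEq Q] {n : ℕ} {out : Fin n ↪ Q}
    {ψ : Amplitudes (Fin n)} {ws : List (Gate Q)}
    (hws : ∀ w ∈ ws, Disjoint w.support (Set.range out)) {χ : Amplitudes Q}
    (h : FactorsThrough out ψ (runGates ws χ)) : FactorsThrough out ψ χ := by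
  induction ws generalizing χ with
  | nil => exact h
  | cons w ws ih =>
    have := (ih (fun v hv => hws v (List.mem_cons_of_mem _ hv)) h).apply w.inv
      (by rw [w.support_inv]; exact hws w List.mem_cons_self)
    rwa [Gate.lin_apply, Gate.apply_inv_apply] at this

theorem factorsThrough_productState {n : ℕ} (out : Fin n ↪ Q) (ψ : Amplitudes (Fin n))
    (φ : Amplitudes {q : Q // q ∉ Set.range out}) :
    FactorsThrough out ψ (productState out ψ φ) :=
  ⟨fun x => φ fun q => x q.1, fun _ _ h => congrArg φ (funext fun q => h q.1 q.2), fun _ => rfl⟩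

/-! ### Counting the parameters of a circuit -/

/-- The matrix entries of a gate. -/
def Gate.entries : Gate Q → Set ℂ
  | single _ U => Set.range fun i : Fin 2 × Fin 2 => U.1 i.1 i.2
  | double _ _ _ U => Set.range fun i : (Fin 2 × Fin 2) × (Fin 2 × Fin 2) => U.1 i.1 i.2

theorem Gate.encard_entries_le (g : Gate Q) : g.entries.encard ≤ 16 := by
  cases g with
  | single q U =>
    rw [entries, ← Set.image_univ]
    refine (Set.encard_image_le _ _).trans ?_
    rw [Set.encard_univ, ENat.card_eq_coe_fintype_card]
    simp
    norm_num
  | double p q h U =>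
    rw [entries, ← Set.image_univ]
    refine (Set.encard_image_le _ _).trans ?_
    rw [Set.encard_univ, ENat.card_eq_coe_fintype_card]
    simp

/-- All the matrix entries of a list of gates. -/
def gateEntries (gs : List (Gate Q)) : Set ℂ := {z | ∃ g ∈ gs, z ∈ g.entries}

theorem encard_gateEntries_le (gs : List (Gate Q)) :
    (gateEntries gs).encard ≤ ((16 * gs.length : ℕ) : ℕ∞) := by
  induction gs with
  | nil => simp [gateEntries]
  | cons g gs ih =>
    have : gateEntries (g :: gs) = g.entries ∪ gateEntries gs := by
      ext z
      simp [gateEntries]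
    rw [this]
    refine (Set.encard_union_le _ _).trans ((add_le_add g.encard_entries_le ih).trans ?_)
    rw [List.length_cons]
    push_cast
    rw [mul_add, add_comm]
    simp

theorem runGates_mem [DecidableEq Q] {S : Type} [SetLike S ℂ] [SubringClass S ℂ] (K : S)
    {gs : List (Gate Q)} (hgs : ∀ z ∈ gateEntries gs, z ∈ K) {χ : Amplitudes Q}
    (hχ : ∀ x, χ x ∈ K) (x : Q → Fin 2) : runGates gs χ x ∈ K := by
  induction gs generalizing χ with
  | nil => exact hχ x
  | cons g gs ih =>
    refine ih (fun z ⟨h, hh, hz⟩ => hgs z ⟨h, List.mem_cons_of_mem _ hh, hz⟩) fun y => ?_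
    have hg (z : ℂ) (hz : z ∈ g.entries) : z ∈ K := hgs z ⟨g, List.mem_cons_self, hz⟩
    cases g with
    | single q U =>
      have (b : Fin 2) : U.1 (y q) b ∈ K := hg _ ⟨(y q, b), rfl⟩
      rw [Gate.lin_apply]
      exact sum_mem fun b _ => mul_mem (this b) (hχ _)
    | double p q h U =>
      have (b : Fin 2 × Fin 2) : U.1 (y p, y q) b ∈ K := hg _ ⟨((y p, y q), b), rfl⟩
      rw [Gate.lin_apply]
      exact sum_mem fun b _ => mul_mem (this b) (hχ _)

end

/-! ### A state of high transcendence degree -/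

theorem exists_algebraicIndependent_complex (ι : Type) [Finite ι] :
    ∃ s : ι → ℂ, AlgebraicIndependent ℚ s := by
  obtain ⟨B, hB⟩ := exists_isTranscendenceBasis ℚ ℂ
  have hcard := IsAlgClosed.cardinal_eq_cardinal_transcendence_basis_of_aleph0_lt' _ hB
    Cardinal.mkRat.le (by rw [Cardinal.mk_complex]; exact Cardinal.aleph0_lt_continuum)
  have hinf : Cardinal.aleph0 ≤ Cardinal.mk B := by
    rw [← hcard, Cardinal.mk_complex]
    exact Cardinal.aleph0_le_continuum
  have hle : Cardinal.mk ι ≤ Cardinal.mk B := (Cardinal.mk_lt_aleph0 (α := ι)).le.trans hinf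
  obtain ⟨f⟩ := hle
  exact ⟨_, hB.1.comp f f.injective⟩

theorem AlgebraicIndependent.card_le_of_isAlgebraic_adjoin {ι : Type} [Fintype ι] {s : ι → ℂ}
    (hs : AlgebraicIndependent ℚ s) {E : Set ℂ}
    (hE : ∀ i, IsAlgebraic (Algebra.adjoin ℚ E) (s i)) : (Fintype.card ι : ℕ∞) ≤ E.encard := by
  let M := AlgebraicIndependent.matroid ℚ ℂ
  have hind : M.Indep (Set.range s) :=
    AlgebraicIndependent.matroid_indep_iff.2 hs.to_subtype_range
  have hsub : Set.range s ⊆ M.closure E := by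
    rintro _ ⟨i, rfl⟩
    rw [AlgebraicIndependent.matroid_closure_eq]
    exact hE i
  calc (Fintype.card ι : ℕ∞) = (Set.range s).encard := by
        rw [← Set.image_univ, hs.injective.encard_image, Set.encard_univ,
          ENat.card_eq_coe_fintype_card]
    _ = M.eRk (Set.range s) := hind.eRk_eq_encard.symm
    _ ≤ M.eRk (M.closure E) := M.eRk_mono hsub
    _ = M.eRk E := M.eRk_closure_eq E
    _ ≤ E.encard := M.eRk_le_encard E

/-- The hard state has amplitudes proportional to `1` at `|0…0⟩` and to algebraically independent
numbers elsewhere. Normalizing it does not change the ratios of its amplitudes. -/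
theorem exists_state_algebraicIndependent (n : ℕ) :
    ∃ ψ : Amplitudes (Fin n), IsState ψ ∧
      AlgebraicIndependent ℚ fun x : {x : Fin n → Fin 2 // x ≠ 0} => ψ x / ψ 0 := by
  obtain ⟨s, hs⟩ := exists_algebraicIndependent_complex {x : Fin n → Fin 2 // x ≠ 0}
  let σ : Amplitudes (Fin n) := fun x => if h : x ≠ 0 then s ⟨x, h⟩ else 1
  let r : ℝ := √(∑ x, ‖σ x‖ ^ 2)
  have hsum : 0 < ∑ x, ‖σ x‖ ^ 2 :=
    Finset.sum_pos' (fun _ _ => by positivity) ⟨0, Finset.mem_univ _, by simp [σ]⟩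
  have hr : 0 < r := Real.sqrt_pos.2 hsum
  have hr' : (r : ℂ) ≠ 0 := by exact_mod_cast hr.ne'
  have h0 : σ 0 = 1 := by simp [σ]
  refine ⟨fun x => σ x / r, ?_, ?_⟩
  · have (x : Fin n → Fin 2) : ‖σ x / (r : ℂ)‖ ^ 2 = ‖σ x‖ ^ 2 / r ^ 2 := by
      rw [norm_div, div_pow, Complex.norm_real, Real.norm_eq_abs, sq_abs]
    simp only [IsState, this, ← Finset.sum_div]
    rw [Real.sq_sqrt hsum.le, div_self hsum.ne']
  · convert hs using 2 with x
    have : σ x = s x := by simp [σ, x.2]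
    beta_reduce
    rw [h0, div_div_div_cancel_right₀ hr', div_one, this]

/-- A circuit that prepares the state `ψ`, up to the state of the ancillas, has enough gates
in the light cone of its outputs to generate all the ratios of the amplitudes of `ψ`. -/
theorem two_pow_le_of_run_eq {n : ℕ} {ψ : Amplitudes (Fin n)}
    (hψ : AlgebraicIndependent ℚ fun x : {x : Fin n → Fin 2 // x ≠ 0} => ψ x / ψ 0)
    {Q : Type} [Fintype Q] [DecidableEq Q] (out : Fin n ↪ Q) (c : Circuit Q)
    (φ : Amplitudes {q : Q // q ∉ Set.range out})
    (hc : c.run (zeroState Q) = productState out ψ φ) :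
    2 ^ n - 1 ≤ 16 * (n * (2 ^ c.depth - 1)) := by
  obtain ⟨gs, ws, hgs, hws, hrun⟩ := exists_light_cone c.layers c.disjoint
    (Finset.univ.map out)
  rw [Finset.card_map, Finset.card_univ, Fintype.card_fin] at hgs
  have hout : ((Finset.univ.map out : Finset Q) : Set Q) = Set.range out := by simp
  rw [hout] at hws
  rw [Circuit.run_eq, hrun, runGates_append, Module.End.mul_apply] at hc
  set χ := runGates gs (zeroState Q) with hχ
  obtain ⟨F, hF, hχF⟩ : FactorsThrough out ψ χ :=
    FactorsThrough.of_runGates hws (hc ▸ factorsThrough_productState out ψ φ)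
  have hχ0 : χ ≠ 0 := fun h => by
    have h' : runGates gs (zeroState Q) = runGates gs 0 := by rw [map_zero, ← h]
    rw [zeroState_eq_ket] at h'
    exact ket_ne_zero _ (runGates_injective gs h')
  obtain ⟨z, hz⟩ : ∃ z, F z ≠ 0 := by
    by_contra! h
    exact hχ0 (funext fun x => by simp [hχF, h])
  have key (x : Fin n → Fin 2) : χ (Function.extend out x z) = ψ x * F z := by
    rw [hχF, Function.extend_comp out.injective]
    congr 1
    exact hF _ _ fun q hq => Function.extend_apply' _ _ _ hq
  have hmem (x : Q → Fin 2) : χ x ∈ Algebra.adjoin ℚ (gateEntries gs) := by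
    refine runGates_mem _ (fun z hz => Algebra.subset_adjoin hz) (fun x => ?_) x
    rw [zeroState_eq_ket, ket]
    split_ifs
    · exact one_mem _
    · exact zero_mem _
  have halg (x : {x : Fin n → Fin 2 // x ≠ 0}) :
      IsAlgebraic (Algebra.adjoin ℚ (gateEntries gs)) (ψ x / ψ 0) := by
    have hA (y : Q → Fin 2) : IsAlgebraic (Algebra.adjoin ℚ (gateEntries gs)) (χ y) :=
      isAlgebraic_algebraMap (⟨χ y, hmem y⟩ : Algebra.adjoin ℚ (gateEntries gs))
    have := (hA (Function.extend out x z)).mul (hA (Function.extend out 0 z)).inv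
    rwa [key, key, ← div_eq_mul_inv, mul_div_mul_right _ _ hz] at this
  have h1 := (hψ.card_le_of_isAlgebraic_adjoin halg).trans (encard_gateEntries_le gs)
  have h2 : Fintype.card {x : Fin n → Fin 2 // x ≠ 0} = 2 ^ n - 1 := by
    rw [Fintype.card_subtype_compl]
    simp
  rw [h2] at h1
  have h3 : 2 ^ n - 1 ≤ 16 * gs.length := by exact_mod_cast h1
  exact h3.trans (Nat.mul_le_mul_left _ hgs)

theorem le_mul_depth_of_two_pow_le {n d : ℕ} (hn : 1 ≤ n)
    (h : 2 ^ n - 1 ≤ 16 * (n * (2 ^ d - 1))) : n ≤ 16 * d := by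
  by_contra! hd
  have hn2 : n < 2 ^ n := Nat.lt_two_pow_self
  rcases Nat.eq_zero_or_pos d with rfl | hd0
  · simp at h
    omega
  · obtain ⟨q, hq⟩ : ∃ q, q = n / 16 := ⟨_, rfl⟩
    have hqn : 16 * q ≤ n ∧ n < 16 * (q + 1) ∧ d ≤ q := by omega
    have h1 : q + 1 ≤ 2 ^ q := Nat.lt_two_pow_self
    have h2 : 2 ^ d ≤ 2 ^ q := Nat.pow_le_pow_right (by norm_num) hqn.2.2
    have h3 : 2 ^ (16 * q) ≤ 2 ^ n := Nat.pow_le_pow_right (by norm_num) hqn.1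
    have h4 : 2 ^ (8 + 2 * q) ≤ 2 ^ (16 * q) := Nat.pow_le_pow_right (by norm_num) (by omega)
    have h5 : 2 ^ (8 + 2 * q) = 256 * (2 ^ q * 2 ^ q) := by ring
    have h6 : n * (2 ^ d - 1) < 16 * 2 ^ q * 2 ^ q := by
      have : n * (2 ^ d - 1) ≤ n * (2 ^ q - 1) := Nat.mul_le_mul_left _ (by omega)
      have h7 : n * (2 ^ q - 1) ≤ 16 * 2 ^ q * (2 ^ q - 1) := Nat.mul_le_mul_right _ (by omega)
      have h8 : 16 * 2 ^ q * (2 ^ q - 1) < 16 * 2 ^ q * 2 ^ q :=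
        Nat.mul_lt_mul_of_pos_left (by omega) (by positivity)
      omega
    have h9 : 16 * 2 ^ q * 2 ^ q = 16 * (2 ^ q * 2 ^ q) := by ring
    omega

theorem exists_state_depth_lower_bound {n : ℕ} (hn : 1 ≤ n) :
    ∃ ψ : Amplitudes (Fin n), IsState ψ ∧
      ∀ (k : ℕ) (out : Fin n ↪ Fin k) (c : Circuit (Fin k))
        (φ : Amplitudes {q : Fin k // q ∉ Set.range out}),
        c.run (zeroState (Fin k)) = productState out ψ φ → 1 / 16 * (n : ℝ) ≤ (c.depth : ℝ) := by
  obtain ⟨ψ, hψ, hind⟩ := exists_state_algebraicIndependent n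
  refine ⟨ψ, hψ, fun k out c φ hc => ?_⟩
  have h : n ≤ 16 * c.depth :=
    le_mul_depth_of_two_pow_le hn (two_pow_le_of_run_eq hind out c φ hc)
  have : (n : ℝ) ≤ 16 * c.depth := by exact_mod_cast h
  linarith

/-! ### Parallel execution of circuits on disjoint registers -/

section

variable {Q : Type}

theorem runGates_flatten_zipWith_cons [DecidableEq Q] {gs : List (Gate Q)}
    {Ls : List (List (Gate Q))} (hlen : gs.length = Ls.length)
    (H : ∀ g ∈ gs, ∀ L ∈ Ls, ∀ h ∈ L, Disjoint g.support h.support) :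
    runGates (List.zipWith List.cons gs Ls).flatten = runGates (gs ++ Ls.flatten) := by
  induction gs generalizing Ls with
  | nil =>
    obtain rfl : Ls = [] := List.length_eq_zero_iff.1 hlen.symm
    rfl
  | cons g gs ih =>
    obtain _ | ⟨L, Ls⟩ := Ls
    · simp at hlen
    · have h1 := ih (Ls := Ls) (by simpa using hlen) fun g hg M hM h hh =>
        H g (List.mem_cons_of_mem _ hg) M (List.mem_cons_of_mem _ hM) h hh
      have h2 : runGates (L ++ gs) = runGates (gs ++ L) :=
        (runGates_append_comm fun g hg h hh =>
          H g (List.mem_cons_of_mem _ hg) L List.mem_cons_self h hh).symm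
      simp only [List.zipWith_cons_cons, List.flatten_cons, List.cons_append]
      rw [runGates, runGates, runGates_append, h1, ← runGates_append, ← List.append_assoc,
        runGates_append, h2, ← runGates_append, List.append_assoc]

/-- Sequences of gates of the same length on disjoint registers can be executed in parallel. -/
theorem exists_parallel_circuit [DecidableEq Q] (G : SimpleGraph Q) {ι : Type} (d : ℕ)
    (track : ι → List (Gate Q)) (S : ι → Set Q) (hd : ∀ j, (track j).length = d)
    (hS : ∀ j, ∀ g ∈ track j, g.support ⊆ S j) (hdisj : Pairwise fun i j => Disjoint (S i) (S j))
    (hG : ∀ j, ∀ g ∈ track j, g.Respects G) {J : List ι} (hJ : J.Nodup) :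
    ∃ c : Circuit Q, c.Respects G ∧ c.depth = d ∧
      ∀ ψ, c.run ψ = runGates (J.flatMap track) ψ := by
  suffices h : ∃ Ls : List (List (Gate Q)), Ls.length = d ∧
      (∀ L ∈ Ls, L.Pairwise fun g h => Disjoint g.support h.support) ∧
      (∀ L ∈ Ls, ∀ g ∈ L, ∃ j ∈ J, g ∈ track j) ∧
      runGates Ls.flatten = runGates (J.flatMap track) by
    obtain ⟨Ls, hlen, hpw, hmem, hrun⟩ := h
    refine ⟨⟨Ls, hpw⟩, fun L hL g hg => ?_, hlen, fun ψ => by rw [Circuit.run_eq, hrun]⟩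
    obtain ⟨j, -, hj⟩ := hmem L hL g hg
    exact hG j g hj
  induction J with
  | nil =>
    refine ⟨List.replicate d [], by simp, ?_, ?_, by simp⟩
    · intro L hL
      rw [List.eq_of_mem_replicate hL]
      exact List.Pairwise.nil
    · intro L hL
      rw [List.eq_of_mem_replicate hL]
      simp
  | cons j J ih =>
    rw [List.nodup_cons] at hJ
    obtain ⟨Ls, hlen, hpw, hmem, hrun⟩ := ih hJ.2
    have hsep : ∀ g ∈ track j, ∀ L ∈ Ls, ∀ h ∈ L, Disjoint g.support h.support := by
      intro g hg L hL h hh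
      obtain ⟨i, hi, hhi⟩ := hmem L hL h hh
      have hij : j ≠ i := fun e => hJ.1 (e ▸ hi)
      exact (hdisj hij).mono (hS j g hg) (hS i h hhi)
    have hzip : ∀ M ∈ List.zipWith List.cons (track j) Ls,
        ∃ g ∈ track j, ∃ L ∈ Ls, M = g :: L := by
      intro M hM
      rw [← List.map_uncurry_zip_eq_zipWith, List.mem_map] at hM
      obtain ⟨⟨g, L⟩, hgL, rfl⟩ := hM
      exact ⟨g, (List.of_mem_zip hgL).1, L, (List.of_mem_zip hgL).2, rfl⟩
    refine ⟨List.zipWith List.cons (track j) Ls, by simp [hd, hlen], ?_, ?_, ?_⟩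
    · intro M hM
      obtain ⟨g, hg, L, hL, rfl⟩ := hzip M hM
      exact List.pairwise_cons.2 ⟨fun h hh => hsep g hg L hL h hh, hpw L hL⟩
    · intro M hM h hh
      obtain ⟨g, hg, L, hL, rfl⟩ := hzip M hM
      rcases List.mem_cons.1 hh with rfl | hh
      · exact ⟨j, List.mem_cons_self, hg⟩
      · obtain ⟨i, hi, hhi⟩ := hmem L hL h hh
        exact ⟨i, List.mem_cons_of_mem _ hi, hhi⟩
    · rw [runGates_flatten_zipWith_cons (by rw [hd, hlen]) hsep, List.flatMap_cons,
        runGates_append, hrun, runGates_append]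

/-! ### Circuits on a small register inside a large one -/

/-- Relabelling of the qubits of a gate. -/
def Gate.map {R : Type} (c : R ↪ Q) : Gate R → Gate Q
  | single q U => single (c q) U
  | double p q h U => double (c p) (c q) (c.injective.ne h) U

theorem Gate.support_map_subset {R : Type} (c : R ↪ Q) (g : Gate R) :
    (g.map c).support ⊆ Set.range c := by
  cases g <;> simp [map, support, Set.insert_subset_iff]

theorem Gate.Respects.map {R : Type} {c : R ↪ Q} {g : Gate R} {G : SimpleGraph R}
    (h : g.Respects G) {G' : SimpleGraph Q} (hG : ∀ i j, G.Adj i j → G'.Adj (c i) (c j)) :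
    (g.map c).Respects G' := by
  cases g
  · trivial
  · exact hG _ _ h

open Classical in
/-- The vector that is `χ` on the small register embedded by `c`, and the basis state `|z⟩` on all
the other qubits. -/
noncomputable def extendBy {R : Type} (c : R ↪ Q) (z : Q → Fin 2) :
    Amplitudes R →ₗ[ℂ] Amplitudes Q where
  toFun χ y := if ∀ q, q ∉ Set.range c → y q = z q then χ (y ∘ c) else 0
  map_add' χ χ' := by
    funext y
    simp only [Pi.add_apply]
    split_ifs <;> simp
  map_smul' a χ := by
    funext y
    simp only [Pi.smul_apply, RingHom.id_apply]
    split_ifs <;> simp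

theorem extendBy_of {R : Type} {c : R ↪ Q} {y z : Q → Fin 2}
    (h : ∀ q, q ∉ Set.range c → y q = z q) (χ : Amplitudes R) : extendBy c z χ y = χ (y ∘ c) :=
  if_pos h

theorem extendBy_of_not {R : Type} {c : R ↪ Q} {y z : Q → Fin 2}
    (h : ¬ ∀ q, q ∉ Set.range c → y q = z q) (χ : Amplitudes R) : extendBy c z χ y = 0 :=
  if_neg h

theorem extendBy_ket {R : Type} (c : R ↪ Q) {x y : Q → Fin 2}
    (h : ∀ q, q ∉ Set.range c → y q = x q) : extendBy c x (ket (y ∘ c)) = ket y := by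
  funext w
  have hw : w = y ↔ (∀ q, q ∉ Set.range c → w q = x q) ∧ w ∘ c = y ∘ c := by
    refine ⟨by rintro rfl; exact ⟨h, rfl⟩, fun ⟨h1, h2⟩ => funext fun q => ?_⟩
    by_cases hq : q ∈ Set.range c
    · obtain ⟨i, rfl⟩ := hq
      exact congrFun h2 i
    · rw [h1 q hq, h q hq]
  simp only [extendBy, ket, LinearMap.coe_mk, AddHom.coe_mk, hw]
  split_ifs <;> tauto

theorem runGates_map_extendBy {R : Type} [DecidableEq R] [DecidableEq Q] (c : R ↪ Q)
    (z : Q → Fin 2) (gs : List (Gate R)) (χ : Amplitudes R) :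
    runGates (gs.map (Gate.map c)) (extendBy c z χ) = extendBy c z (runGates gs χ) := by
  have hupd (y : Q → Fin 2) (i : R) (b : Fin 2) :
      (∀ q, q ∉ Set.range c → Function.update y (c i) b q = z q) ↔
        ∀ q, q ∉ Set.range c → y q = z q := by
    refine forall₂_congr fun q hq => ?_
    rw [Function.update_of_ne]
    rintro rfl
    exact hq ⟨i, rfl⟩
  induction gs generalizing χ with
  | nil => rfl
  | cons g gs ih =>
    simp only [List.map_cons, runGates, Module.End.mul_apply]
    rw [← ih]
    congr 1
    funext y
    simp only [Gate.lin_apply]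
    by_cases hy : ∀ q, q ∉ Set.range c → y q = z q
    · rw [extendBy_of hy]
      cases g <;>
      · simp only [Gate.map, Gate.apply]
        refine Finset.sum_congr rfl fun b _ => ?_
        rw [extendBy_of (by simpa only [hupd] using hy)]
        simp only [Function.update_comp_eq_of_injective _ c.injective, Function.comp_apply]
    · rw [extendBy_of_not hy]
      cases g <;>
      · simp only [Gate.map, Gate.apply]
        refine Finset.sum_eq_zero fun b _ => ?_
        rw [extendBy_of_not (by simpa only [hupd] using hy), mul_zero]

/-- If every circuit of a family on disjoint small registers maps basis state to basis state, then
so does the whole family. -/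
theorem runGates_flatMap_ket [DecidableEq Q] {ι R : Type} [DecidableEq R] {c : ι → R ↪ Q}
    (hc : Pairwise fun i j => Disjoint (Set.range (c i)) (Set.range (c j)))
    {gs : ι → List (Gate R)} {J : List ι} (hJ : J.Nodup) {x y : Q → Fin 2}
    (h : ∀ j ∈ J, runGates (gs j) (ket (x ∘ c j)) = ket (y ∘ c j))
    (hxy : ∀ q, (∀ j ∈ J, q ∉ Set.range (c j)) → y q = x q) :
    runGates (J.flatMap fun j => (gs j).map (Gate.map (c j))) (ket x) = ket y := by
  classical
  induction J generalizing x with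
  | nil =>
    obtain rfl : y = x := funext fun q => hxy q (by simp)
    rfl
  | cons j J ih =>
    rw [List.nodup_cons] at hJ
    let z : Q → Fin 2 := fun q => if q ∈ Set.range (c j) then y q else x q
    have h1 : runGates ((gs j).map (Gate.map (c j))) (ket x) = ket z := by
      rw [← extendBy_ket (c j) (x := x) (y := x) fun _ _ => rfl, runGates_map_extendBy,
        h j List.mem_cons_self]
      have : y ∘ c j = z ∘ c j := funext fun i => by simp [z]
      rw [this, extendBy_ket]
      intro q hq
      simp only [z, hq, if_false]
    rw [List.flatMap_cons, runGates_append, Module.End.mul_apply, h1]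
    refine ih hJ.2 (fun i hi => ?_) fun q hq => ?_
    · have hij : j ≠ i := fun e => hJ.1 (e ▸ hi)
      rw [← h i (List.mem_cons_of_mem _ hi)]
      congr 2
      funext r
      have : c i r ∉ Set.range (c j) := Set.disjoint_right.1 (hc hij) ⟨r, rfl⟩
      simp only [Function.comp_apply, z, this, if_false]
    · by_cases hqj : q ∈ Set.range (c j)
      · simp only [z, hqj, if_true]
      · simp only [z, hqj, if_false]
        refine hxy q fun i hi => ?_
        rcases List.mem_cons.1 hi with rfl | hi
        · exact hqj
        · exact hq i hi

/-! ### Implemented operators -/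

/-- The operator `T` is performed by a circuit of depth `d` along the edges of `G`. -/
def Implements [DecidableEq Q] (G : SimpleGraph Q) (d : ℕ) (T : Module.End ℂ (Amplitudes Q)) :
    Prop :=
  ∃ c : Circuit Q, c.Respects G ∧ c.depth = d ∧ ∀ ψ, c.run ψ = T ψ

theorem Implements.mul [DecidableEq Q] {G : SimpleGraph Q} {d e : ℕ}
    {S T : Module.End ℂ (Amplitudes Q)} (hS : Implements G e S) (hT : Implements G d T) :
    Implements G (d + e) (S * T) := by
  obtain ⟨c, hcG, hcd, hc⟩ := hS
  obtain ⟨b, hbG, hbd, hb⟩ := hT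
  refine ⟨⟨b.layers ++ c.layers, fun L hL => ?_⟩, fun L hL => ?_, ?_, fun ψ => ?_⟩
  · rcases List.mem_append.1 hL with h | h
    · exact b.disjoint L h
    · exact c.disjoint L h
  · rcases List.mem_append.1 hL with h | h
    · exact hbG L h
    · exact hcG L h
  · rw [← hcd, ← hbd]
    exact List.length_append
  · rw [Module.End.mul_apply, ← hb, ← hc]
    exact List.foldl_append

theorem implements_one [DecidableEq Q] (G : SimpleGraph Q) : Implements G 0 1 :=
  ⟨⟨[], by simp⟩, fun L hL => absurd hL (by simp), rfl, fun _ => rfl⟩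

/-- A circuit of depth `d` along the edges of `G` maps the basis state `|A k⟩` to the basis state
`|B k⟩` for all `k` simultaneously. -/
def MapsKets [DecidableEq Q] (G : SimpleGraph Q) (d : ℕ) {κ : Type} (A B : κ → Q → Fin 2) : Prop :=
  ∃ T, Implements G d T ∧ ∀ k, T (ket (A k)) = ket (B k)

theorem MapsKets.trans [DecidableEq Q] {G : SimpleGraph Q} {d e : ℕ} {κ : Type}
    {A B C : κ → Q → Fin 2} (hAB : MapsKets G d A B) (hBC : MapsKets G e B C) :
    MapsKets G (d + e) A C := by
  obtain ⟨T, hT, hTk⟩ := hAB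
  obtain ⟨S, hS, hSk⟩ := hBC
  exact ⟨S * T, hS.mul hT, fun k => by rw [Module.End.mul_apply, hTk, hSk]⟩

theorem MapsKets.iterate [DecidableEq Q] {G : SimpleGraph Q} {d : ℕ} {κ : Type} (r : ℕ)
    {A : ℕ → κ → Q → Fin 2} (h : ∀ i < r, MapsKets G d (A i) (A (i + 1))) :
    MapsKets G (r * d) (A 0) (A r) := by
  induction r with
  | zero => exact ⟨1, by simpa using implements_one G, fun k => rfl⟩
  | succ r ih =>
    rw [add_mul, one_mul]
    exact (ih fun i hi => h i (by omega)).trans (h r (by omega))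

/-- The simultaneous execution of one and the same circuit on disjoint small registers. -/
theorem mapsKets_of_cells [DecidableEq Q] (G : SimpleGraph Q) {ι R κ : Type} [Fintype ι]
    [DecidableEq R] (c : ι → R ↪ Q)
    (hc : Pairwise fun i j => Disjoint (Set.range (c i)) (Set.range (c j)))
    (gs : List (Gate R)) (hG : ∀ j, ∀ g ∈ gs, (g.map (c j)).Respects G)
    {A B : κ → Q → Fin 2} (h : ∀ k j, runGates gs (ket (A k ∘ c j)) = ket (B k ∘ c j))
    (hAB : ∀ k q, (∀ j, q ∉ Set.range (c j)) → B k q = A k q) :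
    MapsKets G gs.length A B := by
  obtain ⟨C, hCG, hCd, hC⟩ := exists_parallel_circuit G gs.length
    (fun j => gs.map (Gate.map (c j))) (fun j => Set.range (c j)) (by simp)
    (fun j g hg => by
      obtain ⟨g, -, rfl⟩ := List.mem_map.1 hg
      exact g.support_map_subset _) hc
    (fun j g hg => by
      obtain ⟨g', hg', rfl⟩ := List.mem_map.1 hg
      exact hG j g' hg') (Finset.nodup_toList Finset.univ)
  refine ⟨_, ⟨C, hCG, hCd, hC⟩, fun k => ?_⟩
  exact runGates_flatMap_ket hc (Finset.nodup_toList _) (fun j _ => h k j)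
    fun q hq => hAB k q fun j => hq j (by simp)

end

/-! ### The gates of the preparation circuit -/

theorem ket_of_eq {Q : Type} {x y : Q → Fin 2} (h : y = x) : ket x y = 1 := if_pos h

theorem ket_of_ne {Q : Type} {x y : Q → Fin 2} (h : y ≠ x) : ket x y = 0 := if_neg h

namespace Gate

variable {Q : Type}

theorem single_lin_ket [DecidableEq Q] (q : Q) (U : Matrix.unitaryGroup (Fin 2) ℂ)
    (x : Q → Fin 2) :
    (single q U).lin (ket x) = ∑ b, U.1 b (x q) • ket (Function.update x q b) := by
  funext y
  have h (b : Fin 2) : Function.update y q b = x ↔ b = x q ∧ y = Function.update x q (y q) := by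
    constructor
    · rintro rfl
      simp
    · rintro ⟨rfl, h⟩
      rw [h, Function.update_idem, Function.update_eq_self]
  have h' (b : Fin 2) : y = Function.update x q b ↔
      b = y q ∧ y = Function.update x q (y q) := by
    constructor
    · intro h
      have : b = y q := by rw [h]; simp
      exact ⟨this, this ▸ h⟩
    · rintro ⟨rfl, h⟩
      exact h
  simp only [lin_apply, apply, Finset.sum_apply, Pi.smul_apply, smul_eq_mul]
  by_cases hy : y = Function.update x q (y q)
  · rw [Finset.sum_eq_single (x q), Finset.sum_eq_single (y q),
      ket_of_eq ((h _).2 ⟨rfl, hy⟩), ket_of_eq ((h' _).2 ⟨rfl, hy⟩)]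
    · exact fun b _ hb => by rw [ket_of_ne fun e => hb ((h' b).1 e).1, mul_zero]
    · exact fun hb => absurd (Finset.mem_univ _) hb
    · exact fun b _ hb => by rw [ket_of_ne fun e => hb ((h b).1 e).1, mul_zero]
    · exact fun hb => absurd (Finset.mem_univ _) hb
  · rw [Finset.sum_eq_zero, Finset.sum_eq_zero]
    · exact fun b _ => by rw [ket_of_ne fun e => hy ((h' b).1 e).2, mul_zero]
    · exact fun b _ => by rw [ket_of_ne fun e => hy ((h b).1 e).2, mul_zero]

theorem double_lin_ket [DecidableEq Q] (p q : Q) (hpq : p ≠ q)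
    (U : Matrix.unitaryGroup (Fin 2 × Fin 2) ℂ) (x : Q → Fin 2) :
    (double p q hpq U).lin (ket x) =
      ∑ b, U.1 b (x p, x q) • ket (Function.update (Function.update x p b.1) q b.2) := by
  funext y
  let z := Function.update (Function.update x p (y p)) q (y q)
  have h (b : Fin 2 × Fin 2) : Function.update (Function.update y p b.1) q b.2 = x ↔
      b = (x p, x q) ∧ y = z := by
    constructor
    · rintro rfl
      refine ⟨by simp [Function.update_of_ne hpq], ?_⟩
      funext r
      by_cases h1 : r = q
      · subst h1; simp [z]
      · by_cases h2 : r = p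
        · subst h2; simp [z, h1]
        · simp [z, h1, h2]
    · rintro ⟨rfl, h⟩
      rw [h]
      funext r
      by_cases h1 : r = q
      · subst h1; simp
      · by_cases h2 : r = p
        · subst h2; simp [h1]
        · simp [z, h1, h2]
  have h' (b : Fin 2 × Fin 2) : y = Function.update (Function.update x p b.1) q b.2 ↔
      b = (y p, y q) ∧ y = z := by
    constructor
    · intro h
      have : b = (y p, y q) := by
        rw [h]
        simp [Function.update_of_ne hpq]
      exact ⟨this, by rw [this] at h; exact h⟩
    · rintro ⟨rfl, h⟩
      exact h
  simp only [lin_apply, apply, Finset.sum_apply, Pi.smul_apply, smul_eq_mul]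
  by_cases hy : y = z
  · rw [Finset.sum_eq_single (x p, x q), Finset.sum_eq_single (y p, y q),
      ket_of_eq ((h _).2 ⟨rfl, hy⟩), ket_of_eq ((h' _).2 ⟨rfl, hy⟩)]
    · exact fun b _ hb => by rw [ket_of_ne fun e => hb ((h' b).1 e).1, mul_zero]
    · exact fun hb => absurd (Finset.mem_univ _) hb
    · exact fun b _ hb => by rw [ket_of_ne fun e => hb ((h b).1 e).1, mul_zero]
    · exact fun hb => absurd (Finset.mem_univ _) hb
  · rw [Finset.sum_eq_zero, Finset.sum_eq_zero]
    · exact fun b _ => by rw [ket_of_ne fun e => hy ((h' b).1 e).2, mul_zero]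
    · exact fun b _ => by rw [ket_of_ne fun e => hy ((h b).1 e).2, mul_zero]

/-- The bit flip. -/
def flip (q : Q) : Gate Q :=
  single q ⟨!![0, 1; 1, 0], by
    rw [Matrix.mem_unitaryGroup_iff]
    ext i j
    fin_cases i <;> fin_cases j <;> simp [Matrix.mul_apply, Matrix.star_apply]⟩

theorem flip_lin_ket [DecidableEq Q] (q : Q) (x : Q → Fin 2) :
    (flip q).lin (ket x) = ket (Function.update x q (x q + 1)) := by
  rw [flip, single_lin_ket]
  obtain h | h : x q = 0 ∨ x q = 1 := by omega
  · simp [h]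
  · simp [h]

/-- The two-qubit gate that permutes the computational basis states. -/
def perm (p q : Q) (hpq : p ≠ q) (σ : Equiv.Perm (Fin 2 × Fin 2)) : Gate Q :=
  double p q hpq ⟨Matrix.of fun a b => if a = σ b then 1 else 0, by
    rw [Matrix.mem_unitaryGroup_iff]
    ext a b
    simp only [Matrix.mul_apply, Matrix.star_apply, Matrix.of_apply, Matrix.one_apply]
    rw [Finset.sum_eq_single (σ.symm a)]
    · simp [eq_comm]
    · intro c _ hc
      have : a ≠ σ c := fun h => hc (by rw [h, Equiv.symm_apply_apply])
      simp [this]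
    · simp⟩

theorem perm_lin_ket [DecidableEq Q] (p q : Q) (hpq : p ≠ q) (σ : Equiv.Perm (Fin 2 × Fin 2))
    (x : Q → Fin 2) : (perm p q hpq σ).lin (ket x) =
      ket (Function.update (Function.update x p (σ (x p, x q)).1) q (σ (x p, x q)).2) := by
  rw [perm, double_lin_ket, Finset.sum_eq_single (σ (x p, x q))]
  · simp
  · intro b _ hb
    simp [hb]
  · simp

/-- The controlled bit flip, with control `p` and target `q`. -/
def cnot (p q : Q) (hpq : p ≠ q) : Gate Q :=
  perm p q hpq ⟨fun a => (a.1, a.1 + a.2), fun a => (a.1, a.1 + a.2), by decide, by decide⟩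

theorem cnot_lin_ket [DecidableEq Q] (p q : Q) (hpq : p ≠ q) (x : Q → Fin 2) :
    (cnot p q hpq).lin (ket x) = ket (Function.update x q (x p + x q)) := by
  rw [cnot, perm_lin_ket]
  simp

/-- The exchange of two qubits. -/
def swap (p q : Q) (hpq : p ≠ q) : Gate Q :=
  perm p q hpq (Equiv.prodComm _ _)

theorem swap_lin_ket [DecidableEq Q] (p q : Q) (hpq : p ≠ q) (x : Q → Fin 2) :
    (swap p q hpq).lin (ket x) =
      ket (Function.update (Function.update x p (x q)) q (x p)) := by
  rw [swap, perm_lin_ket]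
  simp

/-- The two-qubit unitary that fixes `|00⟩` and `|11⟩` and sends `|10⟩` to `a|10⟩ + b|01⟩`. -/
noncomputable def splitMatrix (a b : ℂ) : Matrix (Fin 2 × Fin 2) (Fin 2 × Fin 2) ℂ :=
  Matrix.of fun i j =>
    if i = (1, 0) ∧ j = (1, 0) then a
    else if i = (0, 1) ∧ j = (1, 0) then b
    else if i = (1, 0) ∧ j = (0, 1) then -star b
    else if i = (0, 1) ∧ j = (0, 1) then star a
    else if i = j then 1 else 0

theorem splitMatrix_mem {a b : ℂ} (h : ‖a‖ ^ 2 + ‖b‖ ^ 2 = 1) :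
    splitMatrix a b ∈ Matrix.unitaryGroup (Fin 2 × Fin 2) ℂ := by
  have h' : a * (starRingEnd ℂ) a + b * (starRingEnd ℂ) b = 1 := by
    rw [Complex.mul_conj', Complex.mul_conj']
    exact_mod_cast h
  rw [Matrix.mem_unitaryGroup_iff']
  ext ⟨i, i'⟩ ⟨j, j'⟩
  rw [Matrix.mul_apply, Fintype.sum_prod_type]
  simp only [Fin.sum_univ_two, Matrix.star_apply, splitMatrix, Matrix.of_apply, Matrix.one_apply]
  fin_cases i <;> fin_cases i' <;> fin_cases j <;> fin_cases j' <;> simp <;>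
    first
    | linear_combination h'
    | ring

/-- A gate that moves an excitation from `p` to `q` with amplitude `b` and leaves it with
amplitude `a`. -/
noncomputable def split (p q : Q) (hpq : p ≠ q) {a b : ℂ} (h : ‖a‖ ^ 2 + ‖b‖ ^ 2 = 1) : Gate Q :=
  double p q hpq ⟨splitMatrix a b, splitMatrix_mem h⟩

theorem split_lin_ket_of_eq_zero [DecidableEq Q] {p q : Q} (hpq : p ≠ q) {a b : ℂ}
    (h : ‖a‖ ^ 2 + ‖b‖ ^ 2 = 1) {x : Q → Fin 2} (hp : x p = 0) (hq : x q = 0) :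
    (split p q hpq h).lin (ket x) = ket x := by
  have hx : Function.update (Function.update x p 0) q 0 = x := by
    rw [← hp, Function.update_eq_self, hp, ← hq, Function.update_eq_self]
  rw [split, double_lin_ket, Fintype.sum_prod_type]
  simp [Fin.sum_univ_two, splitMatrix, hp, hq, hx]

theorem split_lin_ket_of_eq_one [DecidableEq Q] {p q : Q} (hpq : p ≠ q) {a b : ℂ}
    (h : ‖a‖ ^ 2 + ‖b‖ ^ 2 = 1) {x : Q → Fin 2} (hp : x p = 1) (hq : x q = 0) :
    (split p q hpq h).lin (ket x) =
      a • ket x + b • ket (Function.update (Function.update x p 0) q 1) := by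
  have hx : Function.update (Function.update x p 1) q 0 = x := by
    rw [← hp, Function.update_eq_self, ← hq, Function.update_eq_self]
  rw [split, double_lin_ket, Fintype.sum_prod_type]
  simp [Fin.sum_univ_two, splitMatrix, hp, hq, hx, add_comm]

/-- The controlled Hadamard transform, with control the first qubit. -/
noncomputable def chadMatrix : Matrix (Fin 2 × Fin 2) (Fin 2 × Fin 2) ℂ :=
  Matrix.of fun i j =>
    if i.1 = 1 ∧ j.1 = 1 then
      if i.2 = 1 ∧ j.2 = 1 then -((√2 / 2 : ℝ) : ℂ) else ((√2 / 2 : ℝ) : ℂ)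
    else if i = j then 1 else 0

theorem chadMatrix_mul_self : chadMatrix * chadMatrix = 1 := by
  have h : ((√2 / 2 : ℝ) : ℂ) * ((√2 / 2 : ℝ) : ℂ) = 1 / 2 := by
    rw [← Complex.ofReal_mul]
    have : √2 / 2 * (√2 / 2) = 1 / 2 := by
      have := Real.mul_self_sqrt (show (0 : ℝ) ≤ 2 by norm_num)
      linarith
    rw [this]
    norm_num
  generalize hs : ((√2 / 2 : ℝ) : ℂ) = s at h
  ext ⟨i, i'⟩ ⟨j, j'⟩
  rw [Matrix.mul_apply, Fintype.sum_prod_type]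
  simp only [Fin.sum_univ_two, chadMatrix, Matrix.of_apply, Matrix.one_apply, hs]
  fin_cases i <;> fin_cases i' <;> fin_cases j <;> fin_cases j' <;> simp <;>
    linear_combination 2 * h

theorem star_chadMatrix : star chadMatrix = chadMatrix := by
  ext ⟨i, i'⟩ ⟨j, j'⟩
  simp only [chadMatrix, Matrix.star_apply, Matrix.of_apply]
  fin_cases i <;> fin_cases i' <;> fin_cases j <;> fin_cases j' <;> simp

/-- The controlled Hadamard gate, with control `p` and target `q`. -/
noncomputable def chad (p q : Q) (hpq : p ≠ q) : Gate Q :=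
  double p q hpq ⟨chadMatrix, by
    rw [Matrix.mem_unitaryGroup_iff, star_chadMatrix, chadMatrix_mul_self]⟩

theorem chad_lin_ket_of_eq_zero [DecidableEq Q] {p q : Q} (hpq : p ≠ q) {x : Q → Fin 2}
    (hp : x p = 0) : (chad p q hpq).lin (ket x) = ket x := by
  have hx : Function.update (Function.update x p 0) q (x q) = x := by
    rw [← hp, Function.update_eq_self, Function.update_eq_self]
  rw [chad, double_lin_ket, Finset.sum_eq_single (0, x q)]
  · simp [chadMatrix, hp, hx]
  · intro b _ hb
    simp [chadMatrix, hp, hb]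
  · simp

theorem chad_lin_ket_of_eq_one [DecidableEq Q] {p q : Q} (hpq : p ≠ q) {x : Q → Fin 2}
    (hp : x p = 1) (hq : x q = 0) : (chad p q hpq).lin (ket x) =
      ((√2 / 2 : ℝ) : ℂ) • (ket x + ket (Function.update x q 1)) := by
  have hx : Function.update x p 1 = x := by rw [← hp, Function.update_eq_self]
  have hx' : Function.update x q 0 = x := by rw [← hq, Function.update_eq_self]
  rw [chad, double_lin_ket, Fintype.sum_prod_type]
  simp [Fin.sum_univ_two, chadMatrix, hp, hq, hx, hx']

theorem chad_lin_chad_lin [DecidableEq Q] {p q : Q} (hpq : p ≠ q) (ψ : Amplitudes Q) :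
    (chad p q hpq).lin ((chad p q hpq).lin ψ) = ψ := by
  have : (chad p q hpq).inv = chad p q hpq := by
    simp only [chad, inv]
    congr 1
    exact Subtype.ext star_chadMatrix
  have h := apply_inv_apply (chad p q hpq) ψ
  rwa [this] at h

end Gate

section

variable {Q : Type} [DecidableEq Q]

theorem mapsKets_flip (G : SimpleGraph Q) (q : Q) {κ : Type} {A B : κ → Q → Fin 2}
    (hq : ∀ k, B k q = A k q + 1) (h : ∀ k p, p ≠ q → B k p = A k p) : MapsKets G 1 A B := by
  refine mapsKets_of_cells G (ι := Unit) (R := Unit)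
    (fun _ => ⟨fun _ => q, fun _ _ _ => rfl⟩)
    (fun _ _ hij => absurd (Subsingleton.elim _ _) hij) [Gate.flip ()]
    (fun _ g hg => ?_) (fun k j => ?_) fun k p hp => ?_
  · rw [List.mem_singleton.1 hg]
    trivial
  · simp only [runGates, one_mul, Gate.flip_lin_ket]
    congr 1
    funext u
    rw [Function.comp_apply, Subsingleton.elim u (), Function.update_self]
    exact (hq k).symm
  · exact h k p fun e => hp () ⟨(), e.symm⟩

/-- A layer of `cnot` gates with controls and targets related by `rel`. -/
theorem mapsKets_cnot [Fintype Q] (G : SimpleGraph Q) (rel : Q → Q → Prop)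
    (hadj : ∀ c t, rel c t → G.Adj c t) (hct : ∀ c t t', rel c t → rel c t' → t = t')
    (htc : ∀ c c' t, rel c t → rel c' t → c = c') (hrel : ∀ c t u, rel c t → ¬ rel t u)
    {κ : Type} {A B : κ → Q → Fin 2} (hB : ∀ k c t, rel c t → B k t = A k c + A k t)
    (h : ∀ k q, (∀ c, ¬ rel c q) → B k q = A k q) : MapsKets G 1 A B := by
  classical
  have hinj (i : {ct : Q × Q // rel ct.1 ct.2}) : Function.Injective ![i.1.1, i.1.2] := by
    have hne : i.1.1 ≠ i.1.2 := (hadj _ _ i.2).ne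
    intro a b hab
    fin_cases a <;> fin_cases b
    · rfl
    · exact absurd hab hne
    · exact absurd hab hne.symm
    · rfl
  refine mapsKets_of_cells G (ι := {ct : Q × Q // rel ct.1 ct.2}) (R := Fin 2)
    (fun i => ⟨![i.1.1, i.1.2], hinj i⟩) ?_ [Gate.cnot 0 1 (by decide)]
    (fun i g hg => ?_) (fun k i => ?_) fun k q hq => ?_
  · rintro ⟨⟨c, t⟩, hi⟩ ⟨⟨c', t'⟩, hj⟩ hij
    simp only at hi hj
    have h1 : c ≠ c' := by
      rintro rfl
      exact hij (by simp [hct _ _ _ hi hj])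
    have h2 : t ≠ t' := by
      rintro rfl
      exact hij (by simp [htc _ _ _ hi hj])
    have h3 : c ≠ t' := by
      rintro rfl
      exact hrel _ _ _ hj hi
    have h4 : t ≠ c' := by
      rintro rfl
      exact hrel _ _ _ hi hj
    simp [h1.symm, h2.symm, h3.symm, h4.symm]
  · rw [List.mem_singleton.1 hg]
    exact hadj _ _ i.2
  · simp only [runGates, one_mul, Gate.cnot_lin_ket]
    congr 1
    funext u
    fin_cases u
    · simp [h k i.1.1 fun c hc => hrel _ _ _ hc i.2]
    · simp [hB k _ _ i.2]
  · refine h k q fun c hc => hq ⟨(c, q), hc⟩ ⟨1, rfl⟩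

end

/-! ### Circuits on a path of six qubits -/

/-- The circuit that lets an excitation of qubit `0` create an excitation of qubit `1` with
amplitude `a` and of qubit `5` with amplitude `b`. -/
noncomputable def branchGates {a b : ℂ} (h : ‖a‖ ^ 2 + ‖b‖ ^ 2 = 1) : List (Gate (Fin 6)) :=
  [.cnot 0 1 (by decide), .split 1 2 (by decide) h, .swap 2 3 (by decide),
    .swap 3 4 (by decide), .swap 4 5 (by decide)]

theorem branchGates_zero {a b : ℂ} (h : ‖a‖ ^ 2 + ‖b‖ ^ 2 = 1) :
    runGates (branchGates h) (ket 0) = ket 0 := by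
  simp only [branchGates, runGates, one_mul, Module.End.mul_apply, Gate.cnot_lin_ket]
  rw [Gate.split_lin_ket_of_eq_zero _ _ (by decide) (by decide)]
  simp only [Gate.swap_lin_ket]
  congr 1
  decide

theorem branchGates_one {a b : ℂ} (h : ‖a‖ ^ 2 + ‖b‖ ^ 2 = 1) :
    runGates (branchGates h) (ket ![1, 0, 0, 0, 0, 0]) =
      a • ket ![1, 1, 0, 0, 0, 0] + b • ket ![1, 0, 0, 0, 0, 1] := by
  simp only [branchGates, runGates, one_mul, Module.End.mul_apply, Gate.cnot_lin_ket]
  rw [Gate.split_lin_ket_of_eq_one _ _ (by decide) (by decide)]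
  simp only [map_add, map_smul, Gate.swap_lin_ket]
  congr 3 <;> decide

/-- The circuit that erases the qubits `1` and `5` when they hold the two products of the value of
qubit `0` with the common value of the qubits `2`, `3`, `4` and with its negation. As the sum of the
two products is the value of qubit `0`, `cnot` gates suffice for qubit `5`. Qubit `1` then holds
the product with the negation, so it has to be flipped in one case and kept at `0` in the other; a
`cnot` between two controlled Hadamard gates does so, since it fixes `|0⟩ + |1⟩`. -/
noncomputable def eraseGates : List (Gate (Fin 6)) :=
  [.cnot 0 1 (by decide), .swap 5 4 (by decide), .swap 4 3 (by decide), .swap 3 2 (by decide)] ++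
  [.cnot 1 2 (by decide), .swap 3 2 (by decide), .swap 4 3 (by decide), .swap 5 4 (by decide)] ++
  [.chad 2 1 (by decide), .cnot 0 1 (by decide), .chad 2 1 (by decide)]

theorem chad_cnot_chad_ket {Q : Type} [DecidableEq Q] {p q r : Q} (hpq : p ≠ q) (hrq : r ≠ q)
    {x : Q → Fin 2} (hx : x q = x p * (x r + 1)) :
    (Gate.chad r q hrq).lin ((Gate.cnot p q hpq).lin ((Gate.chad r q hrq).lin (ket x))) =
      ket (Function.update x q 0) := by
  obtain hr | hr : x r = 0 ∨ x r = 1 := by omega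
  · have hq : x q = x p := by rw [hx, hr, zero_add, mul_one]
    have h2 : x p + x p = 0 := by omega
    rw [Gate.chad_lin_ket_of_eq_zero _ hr, Gate.cnot_lin_ket, hq, h2,
      Gate.chad_lin_ket_of_eq_zero]
    rw [Function.update_of_ne hrq, hr]
  · have hq : x q = 0 := by
      rw [hx, hr]
      exact mul_zero _
    have hfix : (Gate.cnot p q hpq).lin ((Gate.chad r q hrq).lin (ket x)) =
        (Gate.chad r q hrq).lin (ket x) := by
      rw [Gate.chad_lin_ket_of_eq_one _ hr hq, map_smul, map_add, Gate.cnot_lin_ket,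
        Gate.cnot_lin_ket, Function.update_self, Function.update_of_ne hpq,
        Function.update_idem, hq, add_zero]
      obtain hp | hp : x p = 0 ∨ x p = 1 := by omega
      · rw [hp, zero_add, ← hq, Function.update_eq_self]
      · have hu : Function.update x q (1 + 1) = x := by
          conv_rhs => rw [← Function.update_eq_self q x, hq]
          rfl
        rw [hp, hu, add_comm]
    rw [hfix, Gate.chad_lin_chad_lin, ← hq, Function.update_eq_self]

theorem eraseGates_ket (p b : Fin 2) :
    runGates eraseGates (ket ![p, p * b, b, b, b, p * (b + 1)]) = ket ![p, 0, b, b, b, 0] := by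
  have h1 : runGates ([.cnot 0 1 (by decide), .swap 5 4 (by decide), .swap 4 3 (by decide),
      .swap 3 2 (by decide)] : List (Gate (Fin 6)))
      (ket ![p, p * b, b, b, b, p * (b + 1)]) =
      ket ![p, p * (b + 1), p * (b + 1), b, b, b] := by
    simp only [runGates, one_mul, Module.End.mul_apply, Gate.cnot_lin_ket, Gate.swap_lin_ket]
    congr 1
    revert p b
    decide
  have h2 : runGates ([.cnot 1 2 (by decide), .swap 3 2 (by decide), .swap 4 3 (by decide),
      .swap 5 4 (by decide)] : List (Gate (Fin 6)))
      (ket ![p, p * (b + 1), p * (b + 1), b, b, b]) = ket ![p, p * (b + 1), b, b, b, 0] := by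
    simp only [runGates, one_mul, Module.End.mul_apply, Gate.cnot_lin_ket, Gate.swap_lin_ket]
    congr 1
    clear h1
    revert p b
    decide
  rw [eraseGates, runGates_append, runGates_append, Module.End.mul_apply, Module.End.mul_apply,
    h1, h2]
  simp only [runGates, one_mul, Module.End.mul_apply]
  rw [chad_cnot_chad_ket _ _ rfl]
  congr 1
  clear h1 h2
  revert p b
  decide

theorem branchGates_respects {a b : ℂ} (h : ‖a‖ ^ 2 + ‖b‖ ^ 2 = 1) :
    ∀ g ∈ branchGates h, g.Respects (SimpleGraph.pathGraph 6) := by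
  simp [branchGates, Gate.cnot, Gate.swap, Gate.perm, Gate.split, Gate.Respects,
    SimpleGraph.pathGraph_adj]

theorem eraseGates_respects : ∀ g ∈ eraseGates, g.Respects (SimpleGraph.pathGraph 6) := by
  simp [eraseGates, Gate.cnot, Gate.swap, Gate.perm, Gate.chad, Gate.Respects,
    SimpleGraph.pathGraph_adj]

/-- Branching in a single register of a family of disjoint ones, all the others being idle. -/
theorem runGates_flatMap_branchGates {Q : Type} [DecidableEq Q] {ι : Type} {c : ι → Fin 6 ↪ Q}
    (hc : Pairwise fun i j => Disjoint (Set.range (c i)) (Set.range (c j)))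
    {a b : ι → ℂ} (h : ∀ j, ‖a j‖ ^ 2 + ‖b j‖ ^ 2 = 1) {J : List ι} (hJ : J.Nodup) {i : ι}
    (hi : i ∈ J) {x y z : Q → Fin 2} (hx : ∀ j, j ≠ i → x ∘ c j = 0)
    (hxi : x ∘ c i = ![1, 0, 0, 0, 0, 0]) (hyi : y ∘ c i = ![1, 1, 0, 0, 0, 0])
    (hzi : z ∘ c i = ![1, 0, 0, 0, 0, 1]) (hy : ∀ q, q ∉ Set.range (c i) → y q = x q)
    (hz : ∀ q, q ∉ Set.range (c i) → z q = x q) :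
    runGates (J.flatMap fun j => (branchGates (h j)).map (Gate.map (c j))) (ket x) =
      a i • ket y + b i • ket z := by
  obtain ⟨J₁, J₂, rfl⟩ := List.append_of_mem hi
  have hnd := List.nodup_append.1 hJ
  have hJ₂ := List.nodup_cons.1 hnd.2.1
  have hidle (K : List ι) (hK : K.Nodup) (hiK : i ∉ K) (w : Q → Fin 2)
      (hw : ∀ q, q ∉ Set.range (c i) → w q = x q) :
      runGates (K.flatMap fun j => (branchGates (h j)).map (Gate.map (c j))) (ket w) =
        ket w := by
    refine runGates_flatMap_ket hc hK (fun j hj => ?_) fun _ _ => rfl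
    have hji : j ≠ i := fun e => hiK (e ▸ hj)
    have : w ∘ c j = 0 := by
      rw [← hx j hji]
      exact funext fun u => hw _ (Set.disjoint_left.1 (hc hji) ⟨u, rfl⟩)
    rw [this, branchGates_zero]
  have hbranch : runGates ((branchGates (h i)).map (Gate.map (c i))) (ket x) =
      a i • ket y + b i • ket z := by
    rw [← extendBy_ket (c i) (x := x) (y := x) fun _ _ => rfl, runGates_map_extendBy, hxi,
      branchGates_one, map_add, map_smul, map_smul, ← hyi, ← hzi, extendBy_ket _ hy,
      extendBy_ket _ hz]
  rw [List.flatMap_append, List.flatMap_cons, runGates_append, runGates_append,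
    Module.End.mul_apply, Module.End.mul_apply,
    hidle J₁ hnd.1 (fun h => hnd.2.2 _ h _ List.mem_cons_self rfl) x fun _ _ => rfl, hbranch,
    map_add, map_smul, map_smul, hidle J₂ hJ₂.2 hJ₂.1 y hy, hidle J₂ hJ₂.2 hJ₂.1 z hz]

/-! ### The links in use -/

namespace Node

/-- The links along which the gates act: all but those from a node of `H` to its left child. In
`Link` an inner node of `H` has four neighbours. The left child is still within reach of its parent,
through the right child and the leaves and the parent node in `V l` next to them. -/
def Wire : Node → Node → Prop
  | H l j, H l' j' => l' = l + 1 ∧ j' = 2 * j + 1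
  | V l m j, V l' m' j' => l' = l ∧ m' = m + 1 ∧ (j' = 2 * j ∨ j' = 2 * j + 1)
  | H l j, V l' m' j' => l' = l ∧ m' = l ∧ j' = j
  | V _ _ _, H _ _ => False

theorem Wire.link {p q : Node} (h : p.Wire q) : p.Link q := by
  cases p <;> cases q <;> simp only [Wire, Link] at h ⊢
  · exact ⟨h.1, Or.inr h.2⟩
  · exact h
  · exact h

theorem Wire.ne {p q : Node} (h : p.Wire q) : p ≠ q := by
  rintro rfl
  cases p <;> simp only [Wire] at h <;> omega

/-- A set of at most three nodes that contains the neighbours of a valid node. -/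
def near : Node → Finset Node
  | H l j => {H (l + 1) (2 * j + 1), V l l j, H (l - 1) (j / 2)}
  | V l m j => if m = l then {V l (m - 1) (j / 2), H l j} else
      {V l (m + 1) (2 * j), V l (m + 1) (2 * j + 1), V l (m - 1) (j / 2)}

theorem card_near_le (p : Node) : p.near.card ≤ 3 := by
  cases p with
  | H l j => exact Finset.card_le_three
  | V l m j =>
    rw [near]
    split_ifs
    · exact Finset.card_le_two.trans (by norm_num)
    · exact Finset.card_le_three

theorem mem_near {n : ℕ} {p q : Node} (hp : p.Valid n) (hq : q.Valid n)
    (h : p.Wire q ∨ q.Wire p) : q ∈ p.near := by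
  rcases p with ⟨l, j⟩ | ⟨l, m, j⟩ <;> rcases q with ⟨l', j'⟩ | ⟨l', m', j'⟩ <;>
    simp only [Wire, Valid] at h hp hq
  · simp only [near, Finset.mem_insert, Finset.mem_singleton, H.injEq, reduceCtorEq, false_or]
    omega
  · simp only [near, Finset.mem_insert, Finset.mem_singleton, V.injEq, reduceCtorEq, false_or,
      or_false]
    have := h.resolve_right id
    omega
  · obtain ⟨rfl, rfl, rfl⟩ := h.resolve_left id
    simp [near]
  · rw [near]
    split_ifs
    · simp only [Finset.mem_insert, Finset.mem_singleton, V.injEq, reduceCtorEq, or_false]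
      omega
    · simp only [Finset.mem_insert, Finset.mem_singleton, V.injEq]
      omega

end Node

/-- The coupling graph of the preparation circuit. -/
def wireGraph (n : ℕ) : SimpleGraph (TreeQubit n) :=
  SimpleGraph.fromRel fun p q => p.1.Wire q.1

theorem wireGraph_adj {n : ℕ} {p q : TreeQubit n} :
    (wireGraph n).Adj p q ↔ p.1.Wire q.1 ∨ q.1.Wire p.1 := by
  rw [wireGraph, SimpleGraph.fromRel_adj]
  refine ⟨And.right, fun h => ⟨?_, h⟩⟩
  rintro rfl
  exact h.elim (fun h => h.ne rfl) fun h => h.ne rfl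

theorem wireGraph_le (n : ℕ) : wireGraph n ≤ treeGraph n := fun p q h => by
  have hne := h.ne
  rw [wireGraph_adj] at h
  exact (SimpleGraph.fromRel_adj _ _ _).2 ⟨hne, h.imp Node.Wire.link Node.Wire.link⟩

theorem ncard_neighborSet_wireGraph_le {n : ℕ} (p : TreeQubit n) :
    ((wireGraph n).neighborSet p).ncard ≤ 3 := by
  refine le_trans ?_ p.1.card_near_le
  rw [← Set.ncard_coe_finset]
  refine Set.ncard_le_ncard_of_injOn Subtype.val (fun q hq => ?_)
    Subtype.val_injective.injOn (Finset.finite_toSet _)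
  exact Node.mem_near p.2 q.2 (wireGraph_adj.1 hq)

theorem card_treeQubit_le (n : ℕ) : Fintype.card (TreeQubit n) ≤ 6 * 2 ^ n := by
  let e : (Σ l : Fin (n + 1), Fin (2 ^ l.1)) ⊕
      (Σ l : Fin (n + 1), Σ m : Fin (l.1 + 1), Fin (2 ^ m.1)) → Node :=
    Sum.elim (fun a => .H a.1 a.2) fun a => .V a.1 a.2.1 a.2.2
  have he (q : TreeQubit n) : ∃ a, e a = q.1 := by
    obtain ⟨⟨l, j⟩ | ⟨l, m, j⟩, h⟩ := q
    · exact ⟨.inl ⟨⟨l, Nat.lt_succ_of_le h.1⟩, ⟨j, h.2⟩⟩, rfl⟩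
    · exact ⟨.inr ⟨⟨l, Nat.lt_succ_of_le h.2.1⟩, ⟨m, Nat.lt_succ_of_le h.2.2.1⟩,
        ⟨j, h.2.2.2⟩⟩, rfl⟩
  choose f hf using he
  have hinj : Function.Injective f := fun p q h => Subtype.ext (by rw [← hf, ← hf, h])
  refine (Fintype.card_le_of_injective f hinj).trans ?_
  have hgeom (m : ℕ) : ∑ i : Fin (m + 1), 2 ^ i.1 = 2 ^ (m + 1) - 1 := by
    rw [Fin.sum_univ_eq_sum_range (fun i => 2 ^ i), Nat.geomSum_eq le_rfl]
    simp
  have hsum : ∑ l : Fin (n + 1), (2 ^ (l.1 + 1) - 1) ≤ 4 * 2 ^ n := by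
    calc ∑ l : Fin (n + 1), (2 ^ (l.1 + 1) - 1) ≤ ∑ l : Fin (n + 1), 2 * 2 ^ l.1 :=
          Finset.sum_le_sum fun l _ => (Nat.sub_le _ _).trans_eq (by ring)
      _ = 2 * (2 ^ (n + 1) - 1) := by rw [← Finset.mul_sum, hgeom]
      _ ≤ 4 * 2 ^ n := by
          have : 2 ^ (n + 1) = 2 * 2 ^ n := by ring
          omega
  simp only [Fintype.card_sum, Fintype.card_sigma, Fintype.card_fin, hgeom]
  have : 2 ^ (n + 1) = 2 * 2 ^ n := by ring
  omega

/-! ### Basis states of the layout -/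

open Classical in
/-- The assignment of bits under which exactly the nodes with `X` hold `1`. -/
noncomputable def bits {n : ℕ} (X : Node → Prop) : TreeQubit n → Fin 2 :=
  fun q => if X q.1 then 1 else 0

theorem bits_congr {n : ℕ} {X Y : Node → Prop} {q : TreeQubit n} (h : X q.1 ↔ Y q.1) :
    bits X q = bits Y q := by
  unfold bits
  split_ifs <;> tauto

theorem mapsKets_bits_cnot {n : ℕ} {rel : Node → Node → Prop}
    (hwire : ∀ c t, rel c t → c.Wire t ∨ t.Wire c)
    (hct : ∀ c t t', rel c t → rel c t' → t = t')
    (htc : ∀ c c' t, rel c t → rel c' t → c = c') (hrel : ∀ c t u, rel c t → ¬ rel t u)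
    (hvalid : ∀ c t, rel c t → t.Valid n → c.Valid n) {κ : Type} {X Y : κ → Node → Prop}
    (hY : ∀ k c t, rel c t → t.Valid n → (Y k t ↔ ¬ (X k c ↔ X k t)))
    (h : ∀ k t, t.Valid n → (∀ c, ¬ rel c t) → (Y k t ↔ X k t)) :
    MapsKets (wireGraph n) 1 (fun k => bits (X k)) (fun k => bits (Y k)) := by
  refine mapsKets_cnot _ (fun c t => rel c.1 t.1) (fun c t h => wireGraph_adj.2 (hwire _ _ h))
    (fun c t t' h h' => Subtype.ext (hct _ _ _ h h'))
    (fun c c' t h h' => Subtype.ext (htc _ _ _ h h')) (fun c t u => hrel _ _ _)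
    (fun k c t hr => ?_) fun k q hq => ?_
  · have := hY k _ _ hr t.2
    by_cases h1 : X k c.1 <;> by_cases h2 : X k t.1 <;> simp [bits, this, h1, h2]
  · exact bits_congr (h k q.1 q.2 fun c hc => hq ⟨c, hvalid _ _ hc q.2⟩ hc)

/-- Adds to every node of layer `m` of the trees `V l` the sum of its children. -/
theorem mapsKets_fanIn {n : ℕ} (m : ℕ) {κ : Type} {X Y : κ → Node → Prop}
    (hY : ∀ k l j, m < l → l ≤ n → j < 2 ^ m → (Y k (.V l m j) ↔
      ¬ (X k (.V l (m + 1) (2 * j + 1)) ↔ ¬ (X k (.V l (m + 1) (2 * j)) ↔ X k (.V l m j)))))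
    (h : ∀ k q, q.Valid n → (∀ l j, m < l → q ≠ .V l m j) → (Y k q ↔ X k q)) :
    MapsKets (wireGraph n) 2 (fun k => bits (X k)) (fun k => bits (Y k)) := by
  classical
  let rel (e : ℕ) (c t : Node) : Prop :=
    ∃ l j, m < l ∧ c = .V l (m + 1) (2 * j + e) ∧ t = .V l m j
  let Z (k : κ) (q : Node) : Prop := if ∃ l j, m < l ∧ q = .V l m j then
    match q with
    | .H _ _ => False
    | .V l m j => ¬ (X k (.V l (m + 1) (2 * j)) ↔ X k (.V l m j))
    else X k q
  have hZ (k : κ) (l j : ℕ) (hl : m < l) :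
      Z k (.V l m j) ↔ ¬ (X k (.V l (m + 1) (2 * j)) ↔ X k (.V l m j)) := by
    simp only [Z]
    rw [if_pos ⟨l, j, hl, rfl⟩]
  have hZ' (k : κ) (q : Node) (hq : ∀ l j, m < l → q ≠ .V l m j) : Z k q ↔ X k q := by
    simp only [Z]
    rw [if_neg]
    rintro ⟨l, j, hl, e⟩
    exact hq l j hl e
  have hvalid (e : ℕ) (he : e < 2) (c t : Node) (hr : rel e c t) (ht : t.Valid n) :
      c.Valid n := by
    obtain ⟨l, j, hl, rfl, rfl⟩ := hr
    simp only [Node.Valid, pow_succ] at ht ⊢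
    omega
  have hwire (e : ℕ) (he : e < 2) (c t : Node) (hr : rel e c t) : c.Wire t ∨ t.Wire c := by
    obtain ⟨l, j, hl, rfl, rfl⟩ := hr
    simp only [Node.Wire, true_and]
    omega
  have hct (e : ℕ) (c t t' : Node) (hr : rel e c t) (hr' : rel e c t') : t = t' := by
    obtain ⟨l, j, hl, rfl, rfl⟩ := hr
    obtain ⟨l', j', hl', h1, rfl⟩ := hr'
    simp only [Node.V.injEq, true_and] at h1 ⊢
    omega
  have htc (e : ℕ) (c c' t : Node) (hr : rel e c t) (hr' : rel e c' t) : c = c' := by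
    obtain ⟨l, j, hl, rfl, rfl⟩ := hr
    obtain ⟨l', j', hl', rfl, h1⟩ := hr'
    simp only [Node.V.injEq, true_and] at h1 ⊢
    omega
  have hrel (e : ℕ) (c t u : Node) (hr : rel e c t) : ¬ rel e t u := by
    obtain ⟨l, j, hl, rfl, rfl⟩ := hr
    rintro ⟨l', j', hl', h1, rfl⟩
    simp only [Node.V.injEq] at h1
    omega
  refine MapsKets.trans (B := fun k => bits (Z k))
    (mapsKets_bits_cnot (hwire 0 (by norm_num)) (hct 0) (htc 0) (hrel 0) (hvalid 0 (by norm_num))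
      ?_ ?_)
    (mapsKets_bits_cnot (hwire 1 (by norm_num)) (hct 1) (htc 1) (hrel 1) (hvalid 1 (by norm_num))
      ?_ ?_)
  · rintro k _ _ ⟨l, j, hl, rfl, rfl⟩ -
    exact hZ k l j hl
  · exact fun k t _ hr => hZ' k t fun l j hl e => hr _ ⟨l, j, hl, rfl, e⟩
  · rintro k _ _ ⟨l, j, hl, rfl, rfl⟩ ht
    rw [hY k l j hl ht.2.1 ht.2.2.2, hZ k l j hl,
      hZ' k (.V l (m + 1) (2 * j + 1)) fun l' j' _ e => by
        simp only [Node.V.injEq] at e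
        omega]
  · intro k t ht hr
    have hne : ∀ l j, m < l → t ≠ .V l m j := fun l j hl e => hr _ ⟨l, j, hl, rfl, e⟩
    rw [h k t ht hne, hZ' k t hne]

/-- Adds every node of layer `m` of the trees `V l` to both its children. -/
theorem mapsKets_fanOut {n : ℕ} (m : ℕ) {κ : Type} {X Y : κ → Node → Prop}
    (hY : ∀ k l j, m < l → l ≤ n → j < 2 ^ (m + 1) → (Y k (.V l (m + 1) j) ↔
      ¬ (X k (.V l m (j / 2)) ↔ X k (.V l (m + 1) j))))
    (h : ∀ k q, q.Valid n → (∀ l j, q ≠ .V l (m + 1) j) → (Y k q ↔ X k q)) :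
    MapsKets (wireGraph n) 2 (fun k => bits (X k)) (fun k => bits (Y k)) := by
  classical
  let rel (e : ℕ) (c t : Node) : Prop :=
    ∃ l j, c = .V l m j ∧ t = .V l (m + 1) (2 * j + e)
  let Z (k : κ) (q : Node) : Prop := if ∃ l j, q = .V l (m + 1) (2 * j) then Y k q else X k q
  have hvalid (e : ℕ) (he : e < 2) (c t : Node) (hr : rel e c t) (ht : t.Valid n) :
      c.Valid n := by
    obtain ⟨l, j, rfl, rfl⟩ := hr
    simp only [Node.Valid, pow_succ] at ht ⊢
    omega
  have hwire (e : ℕ) (he : e < 2) (c t : Node) (hr : rel e c t) : c.Wire t ∨ t.Wire c := by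
    obtain ⟨l, j, rfl, rfl⟩ := hr
    simp only [Node.Wire, true_and]
    omega
  have hct (e : ℕ) (c t t' : Node) (hr : rel e c t) (hr' : rel e c t') : t = t' := by
    obtain ⟨l, j, rfl, rfl⟩ := hr
    obtain ⟨l', j', h1, rfl⟩ := hr'
    simp only [Node.V.injEq, true_and] at h1 ⊢
    omega
  have htc (e : ℕ) (c c' t : Node) (hr : rel e c t) (hr' : rel e c' t) : c = c' := by
    obtain ⟨l, j, rfl, rfl⟩ := hr
    obtain ⟨l', j', rfl, h1⟩ := hr'
    simp only [Node.V.injEq, true_and] at h1 ⊢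
    omega
  have hrel (e : ℕ) (c t u : Node) (hr : rel e c t) : ¬ rel e t u := by
    obtain ⟨l, j, rfl, rfl⟩ := hr
    rintro ⟨l', j', h1, rfl⟩
    simp only [Node.V.injEq] at h1
    omega
  refine MapsKets.trans (B := fun k => bits (Z k))
    (mapsKets_bits_cnot (hwire 0 (by norm_num)) (hct 0) (htc 0) (hrel 0) (hvalid 0 (by norm_num))
      ?_ ?_)
    (mapsKets_bits_cnot (hwire 1 (by norm_num)) (hct 1) (htc 1) (hrel 1) (hvalid 1 (by norm_num))
      ?_ ?_)
  · rintro k _ _ ⟨l, j, rfl, rfl⟩ ht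
    simp only [Z]
    rw [if_pos ⟨l, j, rfl⟩, hY k l _ ht.2.2.1 ht.2.1 ht.2.2.2]
    have : (2 * j + 0) / 2 = j := by omega
    rw [this]
  · intro k t _ hr
    simp only [Z]
    rw [if_neg]
    rintro ⟨l, j, e⟩
    exact hr _ ⟨l, j, rfl, e⟩
  · rintro k _ _ ⟨l, j, rfl, rfl⟩ ht
    have h1 : Z k (.V l m j) ↔ X k (.V l m j) := by
      simp only [Z]
      rw [if_neg]
      rintro ⟨l', j', e⟩
      simp only [Node.V.injEq] at e
      omega
    have h2 : Z k (.V l (m + 1) (2 * j + 1)) ↔ X k (.V l (m + 1) (2 * j + 1)) := by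
      simp only [Z]
      rw [if_neg]
      rintro ⟨l', j', e⟩
      simp only [Node.V.injEq] at e
      omega
    have : (2 * j + 1) / 2 = j := by omega
    rw [h1, h2, hY k l _ ht.2.2.1 ht.2.1 ht.2.2.2, this]
  · intro k t ht hr
    by_cases he : ∃ l j, t = .V l (m + 1) (2 * j)
    · simp only [Z]
      rw [if_pos he]
    · simp only [Z]
      rw [if_neg he]
      refine h k t ht fun l j e => ?_
      obtain ⟨i, hi | hi⟩ : ∃ i, j = 2 * i ∨ j = 2 * i + 1 := ⟨j / 2, by omega⟩
      · exact he ⟨l, i, hi ▸ e⟩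
      · exact hr _ ⟨l, i, rfl, hi ▸ e⟩

/-- Adds to every odd leaf of the trees `V l` the node of `H` that is linked to it. -/
theorem mapsKets_copyLeaves {n : ℕ} {κ : Type} {X Y : κ → Node → Prop}
    (hY : ∀ k l j, 1 ≤ l → l ≤ n → j < 2 ^ l → j % 2 = 1 →
      (Y k (.V l l j) ↔ ¬ (X k (.H l j) ↔ X k (.V l l j))))
    (h : ∀ k q, q.Valid n → (∀ l j, j % 2 = 1 → q ≠ .V l l j) → (Y k q ↔ X k q)) :
    MapsKets (wireGraph n) 1 (fun k => bits (X k)) (fun k => bits (Y k)) := by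
  refine mapsKets_bits_cnot (rel := fun c t => ∃ l j, j % 2 = 1 ∧ c = .H l j ∧ t = .V l l j)
    ?_ ?_ ?_ ?_ ?_ ?_ ?_
  · rintro _ _ ⟨l, j, hj, rfl, rfl⟩
    simp [Node.Wire]
  · rintro _ _ _ ⟨l, j, hj, rfl, rfl⟩ ⟨l', j', hj', h1, rfl⟩
    simp only [Node.H.injEq] at h1
    rw [h1.1, h1.2]
  · rintro _ _ _ ⟨l, j, hj, rfl, rfl⟩ ⟨l', j', hj', rfl, h1⟩
    simp only [Node.V.injEq] at h1
    rw [h1.1, h1.2.2]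
  · rintro _ _ _ ⟨l, j, hj, rfl, rfl⟩ ⟨l', j', hj', h1, rfl⟩
    cases h1
  · rintro _ _ ⟨l, j, hj, rfl, rfl⟩ ht
    exact ⟨ht.2.1, ht.2.2.2⟩
  · rintro k _ _ ⟨l, j, hj, rfl, rfl⟩ ht
    exact hY k l j ht.1 ht.2.1 ht.2.2.2 hj
  · exact fun k t ht hr => h k t ht fun l j hj e => hr _ ⟨l, j, hj, rfl, e⟩

/-! ### Writing the label of a leaf into the output qubits -/

/-- The ancestor in layer `l` of node `k` of layer `n` of `H`. -/
def ancestor (n k l : ℕ) : ℕ := k / 2 ^ (n - l)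

theorem ancestor_self (n k : ℕ) : ancestor n k n = k := by
  simp [ancestor]

theorem ancestor_eq_half {n l : ℕ} (k : ℕ) (hl : l < n) :
    ancestor n k l = ancestor n k (l + 1) / 2 := by
  have h : n - l = n - (l + 1) + 1 := by omega
  rw [ancestor, ancestor, Nat.div_div_eq_div_mul, h, pow_succ]

theorem ancestor_zero {n k : ℕ} (hk : k < 2 ^ n) : ancestor n k 0 = 0 := by
  rw [ancestor, Nat.sub_zero, Nat.div_eq_of_lt hk]

/-- The nodes holding `1` are those on the path to leaf `k` of `H`, down to layer `t`. -/
def OnPath (n t k : ℕ) : Node → Prop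
  | .H l j => l ≤ t ∧ j = ancestor n k l
  | .V _ _ _ => False

/-- Besides the path to leaf `k` of `H`, every node of `V l` on the path to leaf `ancestor n k l`
holds the parity of `ancestor n k l`, if its layer is in `S` or if it is a leaf. -/
def ParityOnPath (n : ℕ) (S : ℕ → Prop) (k : ℕ) : Node → Prop
  | .H l j => j = ancestor n k l
  | .V l m j => (S m ∨ m = l) ∧ j = ancestor n k m ∧ ancestor n k l % 2 = 1

/-- The part `h` of `H` holds `1`, and every node of `V l` in a layer of `S` holds the parity of
`ancestor n k l`. -/
def ParityOnLayers (n : ℕ) (h : ℕ → ℕ → ℕ → Prop) (S : ℕ → Prop) (k : ℕ) : Node → Prop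
  | .H l j => h k l j
  | .V l m _ => S m ∧ ancestor n k l % 2 = 1

theorem mapsKets_onPath_parityOnPath (n : ℕ) :
    MapsKets (wireGraph n) 1 (fun k : Fin (2 ^ n) => bits (OnPath n n k))
      (fun k => bits (ParityOnPath n (fun m => n ≤ m) k)) := by
  refine mapsKets_copyLeaves (fun k l j _ hl _ hj => ?_) fun k q hq hne => ?_
  · simp only [OnPath, ParityOnPath, hl, true_and, or_true, iff_false, not_not]
    refine ⟨And.left, fun h => ⟨h, h ▸ hj⟩⟩
  · rcases q with ⟨l, j⟩ | ⟨l, m, j⟩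
    · simp only [OnPath, ParityOnPath, hq.1, true_and]
    · simp only [OnPath, ParityOnPath, iff_false]
      rintro ⟨hm, rfl, hodd⟩
      have hml : m = l := hm.elim (fun h => le_antisymm hq.2.2.1 (hq.2.1.trans h)) id
      subst hml
      exact hne _ _ hodd rfl

theorem mapsKets_parityOnPath {n m : ℕ} (hm : m < n) {S S' : ℕ → Prop} (hS : S (m + 1))
    (hSm : S' m ↔ ¬ S m) (hS' : ∀ i, i ≠ m → (S' i ↔ S i)) :
    MapsKets (wireGraph n) 2 (fun k : Fin (2 ^ n) => bits (ParityOnPath n S k))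
      (fun k => bits (ParityOnPath n S' k)) := by
  refine mapsKets_fanIn m (fun k l j hl hln hj => ?_) fun k q hq hne => ?_
  · have h1 := ancestor_eq_half k.1 hm
    have hml : m ≠ l := hl.ne
    simp only [ParityOnPath, hS, hSm, hml, or_false, true_or, true_and]
    by_cases hb : ancestor n k l % 2 = 1
    · simp only [hb, and_true]
      by_cases hj' : j = ancestor n k m
      · have h2 : ¬ (2 * j + 1 = ancestor n k (m + 1) ↔ 2 * j = ancestor n k (m + 1)) := by omega
        simp only [hj', and_true] at h2 ⊢
        tauto
      · have h2 : ¬ 2 * j + 1 = ancestor n k (m + 1) := by omega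
        have h3 : ¬ 2 * j = ancestor n k (m + 1) := by omega
        simp only [hj', h2, h3, and_false, not_true]
    · simp only [hb, and_false, not_true]
  · rcases q with ⟨l, j⟩ | ⟨l, i, j⟩
    · rfl
    · by_cases hi : i = m
      · subst hi
        have : i = l := by
          by_contra hil
          exact hne l j (lt_of_le_of_ne hq.2.2.1 hil) rfl
        simp only [ParityOnPath, this, or_true]
      · simp only [ParityOnPath, hS' i hi]

theorem mapsKets_parityOnPath_parityOnLayers (n : ℕ) :
    MapsKets (wireGraph n) 1
      (fun k : Fin (2 ^ n) => bits (ParityOnPath n (fun m => m = 0 ∨ n - 1 < m) k))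
      (fun k => bits (ParityOnLayers n (fun k l j => j = ancestor n k l) (fun m => m ≤ 0) k)) := by
  refine mapsKets_copyLeaves (fun k l j hl _ _ hj => ?_) fun k q hq hne => ?_
  · have : ¬ l ≤ 0 := by omega
    simp only [ParityOnPath, ParityOnLayers, this, or_true, true_and, false_and, false_iff, not_not]
    refine ⟨fun h => ⟨h, h ▸ hj⟩, And.left⟩
  · rcases q with ⟨l, j⟩ | ⟨l, m, j⟩
    · rfl
    · obtain ⟨hl, hln, hml, hj⟩ := hq
      simp only [ParityOnPath, ParityOnLayers]
      by_cases hm : m = 0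
      · subst hm
        have hj0 : j = ancestor n k 0 := by
          rw [ancestor_zero k.2]
          simpa using hj
        simp only [le_refl, true_or, true_and, hj0]
      · have h0 : ¬ m ≤ 0 := by omega
        simp only [h0, hm, false_and, false_or, false_iff]
        rintro ⟨h, rfl, hodd⟩
        have : m = l := by omega
        subst this
        exact hne _ _ hodd rfl

theorem mapsKets_parityOnLayers {n m : ℕ} (h : ℕ → ℕ → ℕ → Prop) {S S' : ℕ → Prop} (hS : S m)
    (hSm : S' (m + 1) ↔ ¬ S (m + 1)) (hS' : ∀ i, i ≠ m + 1 → (S' i ↔ S i)) :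
    MapsKets (wireGraph n) 2 (fun k : Fin (2 ^ n) => bits (ParityOnLayers n h S k))
      (fun k => bits (ParityOnLayers n h S' k)) := by
  refine mapsKets_fanOut m (fun k l j _ _ _ => ?_) fun k q _ hne => ?_
  · simp only [ParityOnLayers, hS, hSm, true_and]
    tauto
  · rcases q with ⟨l, j⟩ | ⟨l, i, j⟩
    · rfl
    · have hi : i ≠ m + 1 := by
        rintro rfl
        exact hne l j rfl
      simp only [ParityOnLayers, hS' i hi]

/-! ### The six qubits that connect a node of `H` with its children -/

/-- The path from node `j` of layer `t` of `H` to its right child and on, through `V (t + 1)`, to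
its left child. -/
def cellNode (t j : ℕ) : Fin 6 → Node :=
  ![.H t j, .H (t + 1) (2 * j + 1), .V (t + 1) (t + 1) (2 * j + 1), .V (t + 1) t j,
    .V (t + 1) (t + 1) (2 * j), .H (t + 1) (2 * j)]

theorem cellNode_valid {n t j : ℕ} (ht : t < n) (hj : j < 2 ^ t) (a : Fin 6) :
    (cellNode t j a).Valid n := by
  fin_cases a <;> simp [cellNode, Node.Valid, pow_succ] <;> omega

theorem cellNode_inj {t j j' : ℕ} {a b : Fin 6} (h : cellNode t j a = cellNode t j' b) :
    j = j' ∧ a = b := by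
  fin_cases a <;> fin_cases b <;> simp [cellNode] at h ⊢ <;> omega

theorem cellNode_wire {t j : ℕ} {a b : Fin 6} (h : (SimpleGraph.pathGraph 6).Adj a b) :
    (cellNode t j a).Wire (cellNode t j b) ∨ (cellNode t j b).Wire (cellNode t j a) := by
  fin_cases a <;> fin_cases b <;> simp [SimpleGraph.pathGraph_adj] at h <;>
    simp [cellNode, Node.Wire]

/-- The register formed by the nodes `cellNode t j`. -/
def cell {n t : ℕ} (ht : t < n) (j : Fin (2 ^ t)) : Fin 6 ↪ TreeQubit n where
  toFun a := ⟨cellNode t j a, cellNode_valid ht j.2 a⟩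
  inj' _ _ h := (cellNode_inj (Subtype.ext_iff.1 h)).2

theorem cell_disjoint {n t : ℕ} (ht : t < n) :
    Pairwise fun i j => Disjoint (Set.range (cell ht i)) (Set.range (cell ht j)) := by
  intro i j hij
  refine Set.disjoint_left.2 ?_
  rintro _ ⟨a, rfl⟩ ⟨b, hb⟩
  exact hij (Fin.ext (cellNode_inj (Subtype.ext_iff.1 hb)).1.symm)

theorem respects_map_cell {n t : ℕ} (ht : t < n) (j : Fin (2 ^ t)) {g : Gate (Fin 6)}
    (hg : g.Respects (SimpleGraph.pathGraph 6)) : (g.map (cell ht j)).Respects (wireGraph n) :=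
  hg.map fun _ _ h => wireGraph_adj.2 (cellNode_wire h)

/-- Every node of layer `t + 1` of `H` is the last or the second node of some cell. -/
theorem not_mem_cell {n t : ℕ} (ht : t < n) {q : TreeQubit n}
    (hq : ∀ j, q ∉ Set.range (cell ht j)) (j : ℕ) : q.1 ≠ .H (t + 1) j := by
  intro e
  have hv := q.2
  rw [e] at hv
  have hj : j / 2 < 2 ^ t := by
    have := hv.2
    rw [pow_succ] at this
    omega
  obtain h | h : j = 2 * (j / 2) ∨ j = 2 * (j / 2) + 1 := by omega
  · refine hq ⟨j / 2, hj⟩ ⟨5, Subtype.ext ?_⟩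
    rw [e]
    simp [cell, cellNode, ← h]
  · refine hq ⟨j / 2, hj⟩ ⟨1, Subtype.ext ?_⟩
    rw [e]
    simp [cell, cellNode, ← h]

theorem mapsKets_erase {n t : ℕ} (ht : t < n) :
    MapsKets (wireGraph n) 11
      (fun k : Fin (2 ^ n) => bits (ParityOnLayers n
        (fun k l j => l ≤ t + 1 ∧ j = ancestor n k l) (fun m => m ≤ n) k))
      (fun k => bits (ParityOnLayers n
        (fun k l j => l ≤ t ∧ j = ancestor n k l) (fun m => m ≤ n) k)) := by
  refine mapsKets_of_cells (wireGraph n) (cell ht) (cell_disjoint ht) eraseGates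
    (fun j g hg => respects_map_cell ht j (eraseGates_respects g hg)) (fun k j => ?_)
    fun k q hq => bits_congr ?_
  · have h1 := ancestor_eq_half k.1 ht
    have h2 : t + 1 ≤ n := ht
    have h3 : t ≤ n := ht.le
    convert eraseGates_ket (if j = ancestor n k t then 1 else 0)
      (if ancestor n k (t + 1) % 2 = 1 then 1 else 0) using 2
    · congr 1
      funext a
      fin_cases a
      · simp [cell, cellNode, bits, ParityOnLayers]
      · by_cases hj : j = ancestor n k t <;> by_cases hb : ancestor n k (t + 1) % 2 = 1
        all_goals
          simp [cell, cellNode, bits, ParityOnLayers, hj, hb]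
          try omega
      · simp [cell, cellNode, bits, ParityOnLayers, h2]
      · simp [cell, cellNode, bits, ParityOnLayers, h3]
      · simp [cell, cellNode, bits, ParityOnLayers, h2]
      · by_cases hj : j = ancestor n k t <;> by_cases hb : ancestor n k (t + 1) % 2 = 1
        all_goals
          simp [cell, cellNode, bits, ParityOnLayers, hj, hb]
          try omega
    · funext a
      fin_cases a <;> simp [cell, cellNode, bits, ParityOnLayers, h2, h3]
  · obtain ⟨⟨l, j⟩ | ⟨l, m, j⟩, hv⟩ := q
    · have : l ≠ t + 1 := by
        rintro rfl
        exact not_mem_cell ht hq j rfl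
      simp only [ParityOnLayers]
      omega
    · rfl

/-! ### The circuit from leaf to output -/

/-- The nodes holding `1` are the output qubits `V l 0 0` of the layers `l` in which the ancestor of
leaf `k` of `H` is a right child. -/
def OnOutputs (n k : ℕ) : Node → Prop :=
  ParityOnLayers n (fun _ _ _ => False) (fun m => m ≤ 0) k

theorem mapsKets_onPath_onOutputs (n : ℕ) (hn : 1 ≤ n) : ∃ d ≤ 21 * n,
    MapsKets (wireGraph n) d (fun k : Fin (2 ^ n) => bits (OnPath n n k))
      (fun k => bits (OnOutputs n k)) := by
  let path : ℕ → ℕ → ℕ → Prop := fun k l j => j = ancestor n k l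
  let P (S : ℕ → Prop) : Fin (2 ^ n) → TreeQubit n → Fin 2 := fun k => bits (ParityOnPath n S k)
  let L (h : ℕ → ℕ → ℕ → Prop) (S : ℕ → Prop) : Fin (2 ^ n) → TreeQubit n → Fin 2 :=
    fun k => bits (ParityOnLayers n h S k)
  -- Layer by layer, from the leaves up, the copy of an odd leaf on the path is carried to the root
  -- of its tree `V l`, which thereby receives the parity.
  have hfan : MapsKets (wireGraph n) (n * 2) (P fun m => n ≤ m) (P fun m => m = 0 ∨ 0 < m) := by
    have h := MapsKets.iterate (G := wireGraph n) (d := 2) n (A := fun i => P fun m => n ≤ m + i)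
      fun i hi => mapsKets_parityOnPath (m := n - 1 - i) (by omega) (by omega) (by omega)
        fun a ha => by omega
    convert h using 3 <;> omega
  -- The same additions, now from the top down, clear the inner layers below the root.
  have hunfan : MapsKets (wireGraph n) ((n - 1) * 2) (P fun m => m = 0 ∨ 0 < m)
      (P fun m => m = 0 ∨ n - 1 < m) :=
    MapsKets.iterate (d := 2) (n - 1) (A := fun i => P fun m => m = 0 ∨ i < m) fun i hi =>
      mapsKets_parityOnPath (m := i + 1) (by omega) (by omega) (by omega) fun a ha => by omega
  -- With the leaves cleared as well, the root is the only source of the parity, and it can be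
  -- spread without interference to all of `V l`.
  have hspread : MapsKets (wireGraph n) (n * 2) (L path fun m => m ≤ 0) (L path fun m => m ≤ n) :=
    MapsKets.iterate (d := 2) n (A := fun i => L path fun m => m ≤ i) fun i _ =>
      mapsKets_parityOnLayers (m := i) path le_rfl (by omega) fun a ha => by omega
  -- The path in `H` is now determined by the leaves of the trees `V l`, next to it, and is erased
  -- from the bottom up.
  have herase : MapsKets (wireGraph n) (n * 11) (L path fun m => m ≤ n)
      (L (fun k l j => l ≤ 0 ∧ j = ancestor n k l) fun m => m ≤ n) := by
    have h := MapsKets.iterate (G := wireGraph n) (d := 11) n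
      (A := fun i => L (fun k l j => l ≤ n - i ∧ j = ancestor n k l) fun m => m ≤ n) fun i hi => by
        have h1 : n - i = n - (i + 1) + 1 := by omega
        have h2 := mapsKets_erase (n := n) (t := n - (i + 1)) (by omega)
        rw [← h1] at h2
        exact h2
    simp only [Nat.sub_self, Nat.sub_zero] at h
    have hpath : (L path fun m => m ≤ n) =
        L (fun k l j => l ≤ n ∧ j = ancestor n k l) fun m => m ≤ n := by
      funext k q
      refine bits_congr ?_
      obtain ⟨⟨l, j⟩ | ⟨l, m, j⟩, hv⟩ := q
      · simp only [ParityOnLayers, path, hv.1, true_and]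
      · rfl
    rw [hpath]
    exact h
  have hroot : MapsKets (wireGraph n) 1
      (L (fun k l j => l ≤ 0 ∧ j = ancestor n k l) fun m => m ≤ n)
      (L (fun _ _ _ => False) fun m => m ≤ n) := by
    refine mapsKets_flip _ (⟨.H 0 0, by simp [Node.Valid]⟩ : TreeQubit n) (fun k => ?_)
      fun k q hq => bits_congr ?_
    · simp [L, bits, ParityOnLayers, ancestor_zero k.2]
    · obtain ⟨⟨l, j⟩ | ⟨l, m, j⟩, hv⟩ := q
      · simp only [ParityOnLayers, false_iff]
        rintro ⟨hl, rfl⟩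
        obtain rfl : l = 0 := by omega
        exact hq (Subtype.ext (by simp [ancestor_zero k.2]))
      · rfl
  have hunspread : MapsKets (wireGraph n) (n * 2) (L (fun _ _ _ => False) fun m => m ≤ n)
      (L (fun _ _ _ => False) fun m => m ≤ 0) := by
    have h := MapsKets.iterate (G := wireGraph n) (d := 2) n
      (A := fun i => L (fun _ _ _ => False) fun m => m ≤ n - i) fun i hi =>
        mapsKets_parityOnLayers (m := n - (i + 1)) _ (by omega) (by omega) fun a ha => by omega
    simpa only [Nat.sub_self, Nat.sub_zero] using h
  refine ⟨_, ?_, (mapsKets_onPath_parityOnPath n).trans (hfan.trans (hunfan.trans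
    ((mapsKets_parityOnPath_parityOnLayers n).trans (hspread.trans (herase.trans
      (hroot.trans hunspread))))))⟩
  omega

/-! ### Distributing the amplitudes -/

theorem exists_branch_layer {n t : ℕ} (ht : t < n) {a b : ℕ → ℂ}
    (hab : ∀ k, ‖a k‖ ^ 2 + ‖b k‖ ^ 2 = 1) : ∃ T, Implements (wireGraph n) 5 T ∧
      ∀ k < 2 ^ t, T (ket (bits (OnPath t t k))) =
        a k • ket (bits (OnPath (t + 1) (t + 1) (2 * k + 1))) +
          b k • ket (bits (OnPath (t + 1) (t + 1) (2 * k))) := by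
  obtain ⟨c, hcG, hcd, hc⟩ := exists_parallel_circuit (wireGraph n) 5
    (fun j : Fin (2 ^ t) => (branchGates (hab j)).map (Gate.map (cell ht j)))
    (fun j => Set.range (cell ht j)) (fun _ => rfl)
    (fun j g hg => by
      obtain ⟨g', -, rfl⟩ := List.mem_map.1 hg
      exact g'.support_map_subset _)
    (cell_disjoint ht)
    (fun j g hg => by
      obtain ⟨g', hg', rfl⟩ := List.mem_map.1 hg
      exact respects_map_cell ht j (branchGates_respects _ g' hg'))
    (List.nodup_finRange _)
  refine ⟨_, ⟨c, hcG, hcd, hc⟩, fun k hk => ?_⟩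
  have hanc (e l : ℕ) (he : e < 2) (hl : l ≤ t) :
      ancestor (t + 1) (2 * k + e) l = ancestor t k l := by
    have h1 : t + 1 - l = t - l + 1 := by omega
    have h2 : (2 * k + e) / 2 = k := by omega
    rw [ancestor, ancestor, h1, pow_succ', ← Nat.div_div_eq_div_mul, h2]
  have h0 (j : ℕ) : j = ancestor t k t ↔ j = k := by rw [ancestor_self]
  have h1 (e j : ℕ) (he : e < 2) : j = ancestor (t + 1) (2 * k + e) t ↔ j = k := by
    rw [hanc e t he le_rfl, ancestor_self]
  have h2 (e j : ℕ) : j = ancestor (t + 1) (2 * k + e) (t + 1) ↔ j = 2 * k + e := by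
    rw [ancestor_self]
  have hout (e : ℕ) (he : e < 2) (q : TreeQubit n)
      (hq : q ∉ Set.range (cell ht ⟨k, hk⟩)) :
      bits (OnPath (t + 1) (t + 1) (2 * k + e)) q = bits (OnPath t t k) q := by
    refine bits_congr ?_
    obtain ⟨⟨l, j⟩ | ⟨l, m, j⟩, hv⟩ := q
    · simp only [OnPath]
      by_cases hl : l ≤ t
      · simp only [hl, Nat.le_succ_of_le hl, hanc e l he hl]
      · simp only [hl, false_and, iff_false]
        rintro ⟨hl', rfl⟩
        obtain rfl : l = t + 1 := by omega
        refine hq ?_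
        obtain rfl | rfl : e = 0 ∨ e = 1 := by omega
        · exact ⟨5, Subtype.ext (by simp [cell, cellNode, ancestor_self])⟩
        · exact ⟨1, Subtype.ext (by simp [cell, cellNode, ancestor_self])⟩
    · rfl
  have ht1 : ¬ t + 1 ≤ t := by omega
  refine runGates_flatMap_branchGates (a := fun j : Fin (2 ^ t) => a j)
    (b := fun j : Fin (2 ^ t) => b j) (cell_disjoint ht) (fun j => hab j)
    (List.nodup_finRange _) (List.mem_finRange ⟨k, hk⟩) (fun j hj => ?_) ?_ ?_ ?_
    (hout 1 (by norm_num)) (hout 0 (by norm_num))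
  · have hjk : j.1 ≠ k := fun e => hj (Fin.ext e)
    funext u
    fin_cases u <;> simp [cell, cellNode, bits, OnPath, h0, hjk]
  · funext u
    fin_cases u <;> simp [cell, cellNode, bits, OnPath, h0]
  · funext u
    fin_cases u <;> simp [cell, cellNode, bits, OnPath, h1, h2]
  · have h1' := h1 0
    have h2' := h2 0
    simp only [add_zero] at h1' h2'
    funext u
    fin_cases u <;> simp [cell, cellNode, bits, OnPath, h1', h2']

theorem sum_range_two_mul {M : Type*} [AddCommMonoid M] (f : ℕ → M) (m : ℕ) :
    ∑ i ∈ Finset.range (2 * m), f i = ∑ i ∈ Finset.range m, (f (2 * i) + f (2 * i + 1)) := by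
  induction m with
  | zero => simp
  | succ m ih =>
    rw [mul_add, mul_one, Finset.sum_range_succ, Finset.sum_range_succ, ih,
      Finset.sum_range_succ, add_assoc]

/-- A pair of amplitudes is a nonnegative real multiple of a normalized pair. -/
theorem exists_unit_pair (x y : ℂ) : ∃ a b : ℂ, ‖a‖ ^ 2 + ‖b‖ ^ 2 = 1 ∧
    ((√(‖x‖ ^ 2 + ‖y‖ ^ 2) : ℝ) : ℂ) * a = x ∧ ((√(‖x‖ ^ 2 + ‖y‖ ^ 2) : ℝ) : ℂ) * b = y := by
  set r := √(‖x‖ ^ 2 + ‖y‖ ^ 2) with hr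
  have hsq : r ^ 2 = ‖x‖ ^ 2 + ‖y‖ ^ 2 := Real.sq_sqrt (by positivity)
  by_cases h0 : r = 0
  · rw [h0] at hsq
    have hx : ‖x‖ ^ 2 = 0 := by nlinarith [sq_nonneg ‖x‖, sq_nonneg ‖y‖]
    have hy : ‖y‖ ^ 2 = 0 := by nlinarith [sq_nonneg ‖x‖, sq_nonneg ‖y‖]
    have hx' : x = 0 := by simpa using hx
    have hy' : y = 0 := by simpa using hy
    exact ⟨1, 0, by simp, by simp [h0, hx'], by simp [hy']⟩
  · have h0' : (r : ℂ) ≠ 0 := by exact_mod_cast h0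
    refine ⟨x / r, y / r, ?_, mul_div_cancel₀ _ h0', mul_div_cancel₀ _ h0'⟩
    rw [norm_div, norm_div, Complex.norm_real, Real.norm_eq_abs, div_pow, div_pow, sq_abs,
      ← add_div, ← hsq, div_self (pow_ne_zero _ h0)]

/-- The amplitudes are distributed layer by layer. A node receives the norm of the amplitudes of the
leaves below it; only the last layer introduces phases, so a layer `t = 0` of a single node can only
have the amplitude `1`. -/
theorem exists_distribute {n t : ℕ} (ht : t ≤ n) (α : ℕ → ℂ)
    (hα : ∑ k ∈ Finset.range (2 ^ t), ‖α k‖ ^ 2 = 1) (hα0 : t = 0 → α 0 = 1) :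
    ∃ T, Implements (wireGraph n) (1 + t * 5) T ∧ T (zeroState _) =
      ∑ k ∈ Finset.range (2 ^ t), α k • ket (bits (OnPath t t k)) := by
  induction t generalizing α with
  | zero =>
    obtain ⟨T, hT, hTk⟩ := mapsKets_flip (wireGraph n)
      (⟨.H 0 0, by simp [Node.Valid]⟩ : TreeQubit n) (κ := Unit) (A := fun _ => 0)
      (B := fun _ => bits (OnPath 0 0 0)) (fun _ => by simp [bits, OnPath, ancestor])
      fun _ q hq => by
        obtain ⟨⟨l, j⟩ | ⟨l, m, j⟩, hv⟩ := q
        · have : ¬ (l ≤ 0 ∧ j = ancestor 0 0 l) := by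
            rintro ⟨hl, rfl⟩
            obtain rfl : l = 0 := by omega
            exact hq (Subtype.ext (by simp [ancestor]))
          simp only [bits, OnPath, this, if_false]
          rfl
        · simp [bits, OnPath]
    refine ⟨T, hT, ?_⟩
    rw [zeroState_eq_ket]
    simpa [hα0] using hTk ()
  | succ t ih =>
    let β (k : ℕ) : ℝ := √(‖α (2 * k + 1)‖ ^ 2 + ‖α (2 * k)‖ ^ 2)
    have hβ : ∑ k ∈ Finset.range (2 ^ t), ‖(β k : ℂ)‖ ^ 2 = 1 := by
      rw [pow_succ', sum_range_two_mul] at hα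
      rw [← hα]
      refine Finset.sum_congr rfl fun k _ => ?_
      rw [Complex.norm_real, Real.norm_eq_abs, sq_abs, Real.sq_sqrt (by positivity), add_comm]
    have hβ0 : t = 0 → (β 0 : ℂ) = 1 := by
      rintro rfl
      have h : ‖(β 0 : ℂ)‖ ^ 2 = 1 := by simpa using hβ
      rw [Complex.norm_real, Real.norm_of_nonneg (Real.sqrt_nonneg _)] at h
      have : β 0 = 1 := (pow_eq_one_iff_of_nonneg (Real.sqrt_nonneg _) two_ne_zero).1 h
      exact_mod_cast this
    obtain ⟨T, hT, hTz⟩ := ih (by omega) (fun k => β k) hβ hβ0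
    choose a b hab ha hb using fun k => exists_unit_pair (α (2 * k + 1)) (α (2 * k))
    obtain ⟨S, hS, hSk⟩ := exists_branch_layer (n := n) (t := t) ht hab
    refine ⟨S * T, ?_, ?_⟩
    · have h := hS.mul hT
      have e : 1 + t * 5 + 5 = 1 + (t + 1) * 5 := by ring
      rwa [e] at h
    · rw [Module.End.mul_apply, hTz, map_sum, pow_succ', sum_range_two_mul]
      refine Finset.sum_congr rfl fun k hk => ?_
      rw [map_smul, hSk k (Finset.mem_range.1 hk), smul_add, smul_smul, smul_smul, ha, hb, add_comm]

/-! ### The outputs -/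

/-- Leaf `k` of `H` as a string of bits, which say at each layer whether the path to the leaf turns
right. -/
def leafBits {n : ℕ} (k : Fin (2 ^ n)) : Fin n → Fin 2 :=
  fun i => if ancestor n k (i + 1) % 2 = 1 then 1 else 0

theorem leafBits_bijective (n : ℕ) : Function.Bijective (leafBits (n := n)) := by
  refine (Fintype.bijective_iff_injective_and_card _).2 ⟨fun k k' h => ?_, by simp⟩
  have key (l : ℕ) (hl : l ≤ n) : ancestor n k l = ancestor n k' l := by
    induction l with
    | zero => rw [ancestor_zero k.2, ancestor_zero k'.2]
    | succ l ih =>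
      have h1 := ih (by omega)
      rw [ancestor_eq_half _ hl, ancestor_eq_half _ hl] at h1
      have h2 := congrFun h ⟨l, hl⟩
      simp only [leafBits] at h2
      split_ifs at h2 <;> omega
  have := key n le_rfl
  rw [ancestor_self, ancestor_self] at this
  exact Fin.ext this

theorem bits_onOutputs_comp_treeOutput {n : ℕ} (k : Fin (2 ^ n)) :
    bits (OnOutputs n k) ∘ treeOutput n = leafBits k := by
  funext i
  have h : (treeOutput n i).1 = .V (i + 1) 0 0 := rfl
  simp [bits, h, OnOutputs, ParityOnLayers, leafBits]

theorem bits_onOutputs_of_notMem {n : ℕ} (k : Fin (2 ^ n)) {q : TreeQubit n}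
    (hq : q ∉ Set.range (treeOutput n)) : bits (OnOutputs n k) q = 0 := by
  obtain ⟨⟨l, j⟩ | ⟨l, m, j⟩, hv⟩ := q
  · simp [bits, OnOutputs, ParityOnLayers]
  · have hm : m ≠ 0 := by
      rintro rfl
      have hl : 1 ≤ l := hv.1
      have hln : l - 1 < n := by
        have := hv.2.1
        omega
      have hj : j = 0 := by simpa using hv.2.2.2
      refine hq ⟨⟨l - 1, hln⟩, Subtype.ext ?_⟩
      change Node.V (l - 1 + 1) 0 0 = Node.V l 0 j
      rw [hj, Nat.sub_add_cancel hl]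
    simp [bits, OnOutputs, ParityOnLayers, hm]

theorem sum_leafBits_smul_ket {n : ℕ} (ψ : Amplitudes (Fin n)) :
    ∑ k : Fin (2 ^ n), ψ (leafBits k) • ket (bits (OnOutputs n k)) =
      productState (treeOutput n) ψ (zeroState _) := by
  funext y
  simp only [Finset.sum_apply, Pi.smul_apply, smul_eq_mul]
  by_cases hy : ∀ q, q ∉ Set.range (treeOutput n) → y q = 0
  · obtain ⟨k, hk⟩ := (leafBits_bijective n).2 (y ∘ treeOutput n)
    have hyk : y = bits (OnOutputs n k) := by
      funext q
      by_cases hq : q ∈ Set.range (treeOutput n)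
      · obtain ⟨i, rfl⟩ := hq
        have := congrFun (hk.symm.trans (bits_onOutputs_comp_treeOutput k).symm) i
        exact this
      · rw [hy q hq, bits_onOutputs_of_notMem k hq]
    rw [Finset.sum_eq_single k]
    · have hz : zeroState {q : TreeQubit n // q ∉ Set.range (treeOutput n)} (fun q => y q.1) =
          1 := by
        rw [zeroState_eq_ket]
        exact ket_of_eq (funext fun q => hy q.1 q.2)
      rw [ket_of_eq hyk, hk, productState, hz]
      rfl
    · intro k' _ hk'
      rw [ket_of_ne, mul_zero]
      intro h
      refine hk' ((leafBits_bijective n).1 ?_)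
      rw [hk, h, bits_onOutputs_comp_treeOutput]
    · exact fun h => absurd (Finset.mem_univ _) h
  · have hz : zeroState {q : TreeQubit n // q ∉ Set.range (treeOutput n)} (fun q => y q.1) = 0 := by
      rw [zeroState_eq_ket]
      exact ket_of_ne fun h => hy fun q hq => congrFun h ⟨q, hq⟩
    rw [productState, hz, mul_zero]
    refine Finset.sum_eq_zero fun k _ => ?_
    rw [ket_of_ne, mul_zero]
    rintro rfl
    exact hy fun q hq => bits_onOutputs_of_notMem k hq

theorem exists_preparation_circuit {n : ℕ} (hn : 1 ≤ n) {ψ : Amplitudes (Fin n)}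
    (hψ : IsState ψ) : ∃ c : Circuit (TreeQubit n), c.Respects (wireGraph n) ∧
      c.depth ≤ 27 * n ∧
      c.run (zeroState (TreeQubit n)) = productState (treeOutput n) ψ (zeroState _) := by
  let α (k : ℕ) : ℂ := if h : k < 2 ^ n then ψ (leafBits ⟨k, h⟩) else 0
  have hα (k : Fin (2 ^ n)) : α k = ψ (leafBits k) := dif_pos k.2
  have hsum : ∑ k ∈ Finset.range (2 ^ n), ‖α k‖ ^ 2 = 1 := by
    rw [Finset.sum_range]
    simp only [hα]
    rw [(leafBits_bijective n).sum_comp fun x => ‖ψ x‖ ^ 2]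
    exact hψ
  obtain ⟨T, hT, hTz⟩ := exists_distribute (n := n) le_rfl α hsum (by omega)
  obtain ⟨d, hd, S, hS, hSk⟩ := mapsKets_onPath_onOutputs n hn
  obtain ⟨c, hcG, hcd, hc⟩ := hS.mul hT
  refine ⟨c, hcG, by omega, ?_⟩
  rw [hc, Module.End.mul_apply, hTz, map_sum, Finset.sum_range, ← sum_leafBits_smul_ket]
  refine Finset.sum_congr rfl fun k _ => ?_
  rw [map_smul, hSk k, hα]

theorem theorem1 :
    -- upper bound: depth `O(n)` and `O(2 ^ n)` ancillas, with at most three couplings per qubit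
    (∃ A C : ℕ, ∀ n : ℕ, 1 ≤ n →
      Fintype.card (TreeQubit n) ≤ n + A * 2 ^ n ∧
      ∃ G : SimpleGraph (TreeQubit n), G ≤ treeGraph n ∧
        (∀ q : TreeQubit n, (G.neighborSet q).ncard ≤ 3) ∧
        ∀ ψ : Amplitudes (Fin n), IsState ψ →
          ∃ c : Circuit (TreeQubit n), c.Respects G ∧ c.depth ≤ C * n ∧
            c.run (zeroState (TreeQubit n)) = productState (treeOutput n) ψ (zeroState _)) ∧
    -- lower bound: depth `Ω(n)`, whatever the number of ancillas, the couplings and the final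
    -- state of the ancillas
    (∃ a : ℝ, 0 < a ∧ ∀ n : ℕ, 1 ≤ n →
      ∃ ψ : Amplitudes (Fin n), IsState ψ ∧
        ∀ (k : ℕ) (out : Fin n ↪ Fin k) (c : Circuit (Fin k))
          (φ : Amplitudes {q : Fin k // q ∉ Set.range out}),
          c.run (zeroState (Fin k)) = productState out ψ φ → a * (n : ℝ) ≤ (c.depth : ℝ)) := by
  refine ⟨⟨6, 27, fun n hn => ⟨(card_treeQubit_le n).trans (Nat.le_add_left _ _), wireGraph n,
    wireGraph_le n, ncard_neighborSet_wireGraph_le, fun ψ hψ => exists_preparation_circuit hn hψ⟩⟩,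
    1 / 16, by norm_num, fun n hn => exists_state_depth_lower_bound hn⟩
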